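/- Let $K$ be an algebraically closed field, $G$ a linear algebraic group over $K$ (an affine variety over $K$ with a group structure for which multiplication and inversion are morphisms; $G$ need not be connected), $X$ an irreducible affine variety over $K$ on which $G$ acts by a morphism $G\times X\to X$, and $a_1,\dots,a_n$ generators of the $K$-algebra $K[X]$. The group $G$ acts on $K[X]$ by $(\sigma\cdot a)(x)=a(\sigma^{-1}x)$. Let $g_i\in K[G]\otimes_K K[X]$ be the unique element with $g_i(\sigma)=\sigma^{-1}\cdot a_i$ for all $\sigma\in G$. With $L:=K(X)$, the field of fractions of $K[X]$, and indeterminates $y_1,\dots,y_n$, set \[ \widehat D:=(y_1-g_1,\dots,y_n-g_n)\subseteq K[G]\otimes_K L[y_1,\dots,y_n]. \] Let $d$ be the maximal dimension of a $G$-orbit in $X$. Then there exist indices $1\le i_1<\dots<i_d\le n$ such that the classes of $y_{i_1},\dots,y_{i_d}$ in $\bigl(K[G]\otimes_K L[y_1,\dots,y_n]\bigr)/\widehat D$ are algebraically independent over $L$, and there exists a Zariski-open, dense subset $U\subseteq K^d$ such that for every $(\beta_1,\dots,\beta_d)\in U$ the polynomials \[ f_j:=y_{i_j}-\beta_j\in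 K[y_1,\dots,y_n]\qquad(j=1,\dots,d) \] satisfy the following. (1) (Tameness condition) Every element of $K[X]\cap\bigl(f_1(g_1,\dots,g_n),\dots,f_d(g_1,\dots,g_n)\bigr)$, where the ideal is formed in $K[G]\otimes_K L$, is nilpotent (that is, this intersection is contained in $\sqrt{\{0\}}$). (2) With $\widehat E:=\widehat D+(f_1,\dots,f_d)\subseteq K[G]\otimes_K L[y_1,\dots,y_n]$ and $E:=L[y_1,\dots,y_n]\cap\widehat E$, the Krull dimensions satisfy \[ \dim\Bigl(\bigl(K[G]\otimes_K L[y_1,\dots,y_n]\bigr)/\widehat E\Bigr)=\dim(G)-d \qquad\text{and}\qquad \dim\bigl(L[y_1,\dots,y_n]/E\bigr)=0 . \] -/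

import Mathlib

open scoped TensorProduct

noncomputable section

namespace CrossSection

/-- An affine variety over `K` (in the classical sense, `K` algebraically closed in all uses): a set
`X` with a finitely generated `K`-algebra `K[X]` of functions `X → K`, such that the points of `X`
correspond bijectively, by evaluation, to the `K`-algebra homomorphisms `K[X] → K`. -/
class AffineVariety (K : Type*) [Field K] (X : Type*) where
  regular : Subalgebra K (X → K)
  regular_fg : regular.FG
  existsUnique_point : ∀ φ : regular →ₐ[K] K, ∃! x : X, ∀ f : regular, φ f = f.1 x

/-- The coordinate ring `K[X]`. -/
abbrev CoordRing (K : Type*) [Field K] (X : Type*) [AffineVariety K X] : Type _ :=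
  ↥(AffineVariety.regular (K := K) (X := X))

/-- Evaluation of regular functions at a point. -/
def evalAt (K : Type*) [Field K] {X : Type*} [AffineVariety K X] (x : X) : CoordRing K X →ₐ[K] K :=
  (Pi.evalAlgHom K (fun _ : X => K) x).comp (AffineVariety.regular (K := K) (X := X)).val

/-- A morphism of affine varieties: regular functions pull back to regular functions. -/
def IsMorphism (K : Type*) [Field K] {X Y : Type*} [AffineVariety K X] [AffineVariety K Y]
    (φ : X → Y) : Prop :=
  ∀ f ∈ AffineVariety.regular (K := K) (X := Y), f ∘ φ ∈ AffineVariety.regular (K := K) (X := X)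

/-- The closed subset of `X` defined by a set of regular functions. -/
def zeros {K : Type*} [Field K] {X : Type*} [AffineVariety K X] (S : Set (CoordRing K X)) : Set X :=
  {x | ∀ f ∈ S, f.1 x = 0}

/-- The Zariski topology. -/
@[reducible]
def zariski (K : Type*) [Field K] (X : Type*) [AffineVariety K X] : TopologicalSpace X :=
  TopologicalSpace.ofClosed {Z | ∃ S : Set (CoordRing K X), Z = zeros S}
    ⟨{1}, by ext x; simp [zeros]⟩
    (by
      intro A hA
      refine ⟨{f | ∃ S : Set (CoordRing K X), zeros S ∈ A ∧ f ∈ S}, ?_⟩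
      ext x
      constructor
      · rintro hx f ⟨S, hS, hf⟩
        exact hx _ hS f hf
      · intro hx Z hZ
        obtain ⟨S, rfl⟩ := hA hZ
        exact fun f hf => hx f ⟨S, hZ, hf⟩)
    (by
      rintro _ ⟨S, rfl⟩ _ ⟨T, rfl⟩
      refine ⟨{h | ∃ f ∈ S, ∃ g ∈ T, h = f * g}, ?_⟩
      ext x
      constructor
      · rintro (hx | hx) _ ⟨f, hf, g, hg, rfl⟩
        · simp [hx f hf]
        · simp [hx g hg]
      · intro hx
        by_contra hcon
        simp only [Set.mem_union, not_or] at hcon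
        obtain ⟨h1, h2⟩ := hcon
        simp only [zeros, Set.mem_ofPred_eq, not_forall] at h1 h2
        obtain ⟨f, hf, hfx⟩ := h1
        obtain ⟨g, hg, hgx⟩ := h2
        have := hx (f * g) ⟨f, hf, g, hg, rfl⟩
        simp [hfx, hgx] at this)

/-- `X` is irreducible (in particular nonempty) in the Zariski topology. -/
def IsIrreducibleVariety (K : Type*) [Field K] (X : Type*) [AffineVariety K X] : Prop :=
  @IrreducibleSpace X (zariski K X)

/-- The dimension of a subset of a variety: the Krull dimension of the subset as a topological
space, with the topology induced by the Zariski topology. -/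
def dimSubset (K : Type*) [Field K] {X : Type*} [AffineVariety K X] (S : Set X) : WithBot ℕ∞ :=
  @topologicalKrullDim S ((zariski K X).induced Subtype.val)

/-- The dimension of a variety. -/
def dimVariety (K : Type*) [Field K] (X : Type*) [AffineVariety K X] : WithBot ℕ∞ :=
  @topologicalKrullDim X (zariski K X)

/-- Affine `d`-space `K^d`, whose regular functions are the polynomial functions. -/
instance affineSpace (K : Type*) [Field K] (d : ℕ) : AffineVariety K (Fin d → K) where
  regular := Algebra.adjoin K (Set.range fun (i : Fin d) (x : Fin d → K) => x i)
  regular_fg := by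
    rw [← Set.Finite.coe_toFinset (Set.finite_range fun (i : Fin d) (x : Fin d → K) => x i)]
    exact Subalgebra.fg_adjoin_finset _
  existsUnique_point := by
    intro φ
    refine ⟨fun i => φ ⟨fun x => x i, Algebra.subset_adjoin ⟨i, rfl⟩⟩, ?_, ?_⟩
    · rintro ⟨f, hf⟩
      induction hf using Algebra.adjoin_induction with
      | mem f hf => obtain ⟨i, rfl⟩ := hf; rfl
      | algebraMap r => exact φ.commutes r
      | add f g hf hg h1 h2 =>
        exact (map_add φ ⟨f, hf⟩ ⟨g, hg⟩).trans (congrArg₂ (· + ·) h1 h2)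
      | mul f g hf hg h1 h2 =>
        exact (map_mul φ ⟨f, hf⟩ ⟨g, hg⟩).trans (congrArg₂ (· * ·) h1 h2)
    · intro x hx
      funext i
      exact (hx ⟨fun x => x i, Algebra.subset_adjoin ⟨i, rfl⟩⟩).symm

/-- An element of `K[X] ⊗ K[Y]` as a function on `X × Y`: `f ⊗ h` is `(x, y) ↦ f(x) h(y)`. -/
def tensorToFun (K : Type*) [Field K] (X Y : Type*) [AffineVariety K X] [AffineVariety K Y] :
    CoordRing K X ⊗[K] CoordRing K Y →ₐ[K] (X × Y → K) :=
  AlgHom.pi fun p : X × Y =>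
    Algebra.TensorProduct.lift (evalAt K p.1) (evalAt K p.2) fun _ _ => Commute.all _ _

theorem tensorToFun_tmul {K : Type*} [Field K] {X Y : Type*} [AffineVariety K X]
    [AffineVariety K Y] (f : CoordRing K X) (h : CoordRing K Y) (p : X × Y) :
    tensorToFun K X Y (f ⊗ₜ[K] h) p = f.1 p.1 * h.1 p.2 := by
  simp [tensorToFun, evalAt]

/-- The product of two affine varieties: the regular functions on `X × Y` are the finite sums of
functions `(x, y) ↦ f(x) h(y)` with `f ∈ K[X]` and `h ∈ K[Y]`. -/
instance prodVariety (K : Type*) [Field K] (X Y : Type*) [AffineVariety K X] [AffineVariety K Y] :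
    AffineVariety K (X × Y) where
  regular := (tensorToFun K X Y).range
  regular_fg := by
    have h1 : Algebra.FiniteType K (CoordRing K X) :=
      (Subalgebra.fg_iff_finiteType _).1 AffineVariety.regular_fg
    have h2 : Algebra.FiniteType K (CoordRing K Y) :=
      (Subalgebra.fg_iff_finiteType _).1 AffineVariety.regular_fg
    have h3 : Algebra.FiniteType K (CoordRing K X ⊗[K] CoordRing K Y) :=
      Algebra.FiniteType.trans h1 inferInstance
    rw [← Algebra.map_top]
    exact h3.out.map _
  existsUnique_point := by
    intro φ
    let ψ := φ.comp (tensorToFun K X Y).rangeRestrict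
    obtain ⟨x, hx, hx'⟩ := AffineVariety.existsUnique_point
      (ψ.comp (Algebra.TensorProduct.includeLeft (R := K) (S := K)))
    obtain ⟨y, hy, hy'⟩ := AffineVariety.existsUnique_point
      (ψ.comp (Algebra.TensorProduct.includeRight (R := K)))
    refine ⟨(x, y), ?_, ?_⟩
    · rintro ⟨_, t, rfl⟩
      have key : ψ = (Pi.evalAlgHom K (fun _ : X × Y => K) (x, y)).comp (tensorToFun K X Y) := by
        apply Algebra.TensorProduct.ext
        · ext f
          refine (hx f).trans ?_
          simp [tensorToFun_tmul]
        · ext h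
          refine (hy h).trans ?_
          simp [tensorToFun_tmul]
      exact DFunLike.congr_fun key t
    · rintro ⟨x₁, y₁⟩ h
      refine Prod.ext (hx' x₁ fun f => ?_) (hy' y₁ fun f => ?_)
      · refine (h _).trans ?_
        simp [tensorToFun_tmul]
      · refine (h _).trans ?_
        simp [tensorToFun_tmul]

/-- A linear algebraic group: an affine variety with a group structure whose multiplication and
inversion are morphisms. -/
class LinearAlgebraicGroup (K : Type*) [Field K] (G : Type*) [Group G] [AffineVariety K G] :
    Prop where
  isMorphism_mul : IsMorphism K fun p : G × G => p.1 * p.2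
  isMorphism_inv : IsMorphism K fun σ : G => σ⁻¹

/-- A (affine) `G`-variety: `G` acts on the affine variety `X` by a morphism `G × X → X`. -/
class GVariety (K : Type*) [Field K] (G X : Type*) [Group G] [AffineVariety K G]
    [AffineVariety K X] [MulAction G X] : Prop where
  isMorphism_smul : IsMorphism K fun p : G × X => p.1 • p.2

theorem exists_coaction (K : Type*) [Field K] (G : Type*) {X : Type*} [Group G] [AffineVariety K G]
    [AffineVariety K X] [MulAction G X] [GVariety K G X] (f : CoordRing K X) :
    ∃ g : CoordRing K X ⊗[K] CoordRing K G, ∀ (σ : G) (x : X),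
      tensorToFun K X G g (x, σ) = f.1 (σ • x) := by
  obtain ⟨t, ht⟩ := GVariety.isMorphism_smul (K := K) (G := G) f.1 f.2
  refine ⟨Algebra.TensorProduct.comm K _ _ t, fun σ x => ?_⟩
  have key : ∀ t : CoordRing K G ⊗[K] CoordRing K X,
      tensorToFun K X G (Algebra.TensorProduct.comm K _ _ t) (x, σ) =
        tensorToFun K G X t (σ, x) := by
    intro t
    induction t with
    | zero => simp
    | tmul a b => simp [tensorToFun_tmul, mul_comm]
    | add a b ha hb => simp only [map_add, Pi.add_apply, ha, hb]
  rw [key t]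
  exact congrFun ht (σ, x)

/-- For `a ∈ K[X]`, the element `g ∈ K[X] ⊗ K[G]` with `g(σ) = σ⁻¹ · a` for all `σ ∈ G`, where
`σ⁻¹ · a` is the regular function `x ↦ a(σ x)`. By `coaction_unique` there is only one. -/
def coaction (K : Type*) [Field K] (G : Type*) {X : Type*} [Group G] [AffineVariety K G]
    [AffineVariety K X] [MulAction G X] [GVariety K G X] (a : CoordRing K X) :
    CoordRing K X ⊗[K] CoordRing K G :=
  Classical.choose (exists_coaction K G a)

theorem coaction_spec (K : Type*) [Field K] {G X : Type*} [Group G] [AffineVariety K G]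
    [AffineVariety K X] [MulAction G X] [GVariety K G X] (a : CoordRing K X) (σ : G) (x : X) :
    tensorToFun K X G (coaction K G a) (x, σ) = a.1 (σ • x) :=
  Classical.choose_spec (exists_coaction K G a) σ x

theorem tensorToFun_injective (K : Type*) [Field K] (X Y : Type*) [AffineVariety K X]
    [AffineVariety K Y] : Function.Injective (tensorToFun K X Y) := by
  rw [injective_iff_map_eq_zero]
  intro t ht
  let b := Module.Basis.ofVectorSpace K (CoordRing K Y)
  obtain ⟨c, rfl⟩ := TensorProduct.eq_repr_basis_right b t
  have hc : c = 0 := by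
    ext i x
    have h0 : ∑ j ∈ c.support, (c j).1 x • b j = 0 := by
      ext y
      have := congrFun ht (x, y)
      simp only [Finsupp.sum, map_sum, Finset.sum_apply, tensorToFun_tmul] at this
      simpa using this
    by_cases hi : i ∈ c.support
    · simpa using linearIndependent_iff'.1 b.linearIndependent _ _ h0 i hi
    · simp [Finsupp.notMem_support_iff.1 hi]
  simp [hc]

theorem coaction_unique (K : Type*) [Field K] {G X : Type*} [Group G] [AffineVariety K G]
    [AffineVariety K X] [MulAction G X] [GVariety K G X] (a : CoordRing K X)
    (g : CoordRing K X ⊗[K] CoordRing K G)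
    (hg : ∀ (σ : G) (x : X), tensorToFun K X G g (x, σ) = a.1 (σ • x)) : g = coaction K G a := by
  apply tensorToFun_injective K X G
  funext p
  rw [show p = (p.1, p.2) from rfl, hg, coaction_spec]

/-! In the following, `L` is the field of fractions `K(X)` of `K[X]`, as a `K`-algebra. -/

/-- The ring `K[G] ⊗ L[y₁, …, yₙ]`, the tensor product being over `K`. The factor
`L[y₁, …, yₙ]` is written on the left, so that Mathlib provides the structure of an `L`-algebra. -/
abbrev BigRing (K : Type*) [Field K] (G : Type*) [AffineVariety K G] (L : Type*) [Field L]
    [Algebra K L] (n : ℕ) : Type _ :=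
  MvPolynomial (Fin n) L ⊗[K] CoordRing K G

section

variable (K : Type*) [Field K] (G : Type*) [Group G] [AffineVariety K G] (X : Type*)
  [AffineVariety K X] (L : Type*) [Field L] [Algebra K L] {n s : ℕ}

/-- The indeterminate `yᵢ` as an element of `K[G] ⊗ L[y₁, …, yₙ]`. -/
def indet (i : Fin n) : BigRing K G L n :=
  MvPolynomial.X i ⊗ₜ[K] 1

/-- The map `K[y₁, …, yₙ] → K[G] ⊗ L[y₁, …, yₙ]`. -/
def polyIncl : MvPolynomial (Fin n) K →ₐ[K] BigRing K G L n :=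
  MvPolynomial.aeval (indet K G L)

variable [Algebra (CoordRing K X) L] [IsScalarTower K (CoordRing K X) L]

/-- The map `K[G] ⊗ K[X] → K[G] ⊗ L`. -/
def inclL : CoordRing K X ⊗[K] CoordRing K G →ₐ[K] L ⊗[K] CoordRing K G :=
  Algebra.TensorProduct.map (IsScalarTower.toAlgHom K (CoordRing K X) L)
    (AlgHom.id K (CoordRing K G))

/-- The map `K[G] ⊗ L → K[G] ⊗ L[y₁, …, yₙ]`. -/
def inclPoly (n : ℕ) : L ⊗[K] CoordRing K G →ₐ[K] BigRing K G L n :=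
  Algebra.TensorProduct.map (IsScalarTower.toAlgHom K L (MvPolynomial (Fin n) L))
    (AlgHom.id K (CoordRing K G))

variable {X} [MulAction G X] [GVariety K G X]

/-- The ideal `D̂ = (y₁ - g₁, …, yₙ - gₙ)` of `K[G] ⊗ L[y₁, …, yₙ]`, where `gᵢ(σ) = σ⁻¹ · aᵢ`. -/
def DHat (a : Fin n → CoordRing K X) : Ideal (BigRing K G L n) :=
  Ideal.span (Set.range fun i =>
    indet K G L i - inclPoly K G L n (inclL K G X L (coaction K G (a i))))

/-- The ideal `Ê = D̂ + (f₁, …, fₛ)` of `K[G] ⊗ L[y₁, …, yₙ]`. -/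
def EHat (a : Fin n → CoordRing K X) (f : Fin s → MvPolynomial (Fin n) K) :
    Ideal (BigRing K G L n) :=
  DHat K G L a ⊔ Ideal.span (Set.range fun j => polyIncl K G L (f j))

/-- The elimination ideal `E = L[y₁, …, yₙ] ∩ Ê`. -/
def EElim (a : Fin n → CoordRing K X) (f : Fin s → MvPolynomial (Fin n) K) :
    Ideal (MvPolynomial (Fin n) L) :=
  (EHat K G L a f).comap (Algebra.TensorProduct.includeLeft (R := K) (S := K)
    (A := MvPolynomial (Fin n) L) (B := CoordRing K G))

/-- The condition `K[X] ∩ (f₁(g₁, …, gₙ), …, fₛ(g₁, …, gₙ)) ⊆ √{0}`, where the ideal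
`(f₁(g₁, …, gₙ), …, fₛ(g₁, …, gₙ))` is formed in `K[G] ⊗ L`. -/
def TameCondition (a : Fin n → CoordRing K X) (f : Fin s → MvPolynomial (Fin n) K) : Prop :=
  ∀ r : CoordRing K X,
    inclL K G X L (r ⊗ₜ[K] 1) ∈ Ideal.span (Set.range fun j =>
      MvPolynomial.aeval (fun i => inclL K G X L (coaction K G (a i))) (f j)) →
    IsNilpotent r

end

end CrossSection

end

/-!
Write `S = L ⊗ K[G]` and let `g₁, …, gₙ ∈ S` be the elements with `gᵢ(σ) = σ⁻¹ · aᵢ`. Substituting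
`gᵢ` for `yᵢ` is a surjection `L[y₁, …, yₙ] ⊗ K[G] → S` with kernel `D̂` (`ker_graphHom`). Hence the
classes of the `yᵢ` modulo `D̂` are as independent as the `gᵢ`, the ring modulo `Ê` is
`S / (g_{i₁} - β₁, …, g_{i_d} - β_d)`, and `E` is the kernel of `L[y₁, …, yₙ]` mapping to that ring.
Geometrically, the `gᵢ` are the coordinates of the orbit map of the generic point of `X`, and the
ring modulo `Ê` is the coordinate ring of the fibre of `d` of them.

*Independence.* For a point `x`, the functions `σ ↦ aᵢ(σ x)` on `G` contain `r` algebraically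
independent ones if and only if the orbit of `x` has dimension at least `r`
(`le_dimSubset_orbit_of_algebraicIndependent`,
`exists_algebraicIndependent_of_le_dimSubset_orbit`). Algebraic independence passes from a special
point to the generic one, by reducing a relation modulo a place of `L` centred at the special point
(`algebraicIndependent_of_specialization`), and from the generic point to the special points in a
nonempty open set (`exists_algebraicIndependent_specialization`). So some `d` of the `gᵢ` are
algebraically independent over `L`, where `d` is the maximal orbit dimension, and no `d + 1` are.

*Dimension of `Ê`.* Noether normalization of `S` over the polynomial ring in the chosen `d`
elements, after inverting one nonzero polynomial (`exists_mvPolynomial_isIntegralAway`), makes `S` generically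
integral over a polynomial ring in `d + e` variables over `L`. Going up then shows that the fibres
over general points `β` have dimension `e` (`exists_ringKrullDim_fibre`). That `d + e = dim G`
requires every nonempty open subset of `Spec S` to have dimension `dim G`; this holds because the
translations permute the components of `G` transitively (`exists_prime_tensor_of_transitive`).

*Dimension of `E` and tameness.* Each `g_k` satisfies a relation with the chosen `d` elements, which
for general `β` specializes to a nonzero polynomial over `L` that kills the class of `y_k` modulo
`E` (`exists_aeval_mem_span_sub`); so `L[y₁, …, yₙ] / E` is integral over `L`. The fibre is nonempty
by the dimension formula, so the ideal `(g_{i_j} - β_j)` of `S` is proper and contains no nonzero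
element of `K[X]`, as these are units of `L`.

The conditions on `β` are the nonvanishing of polynomials over `L`; applying a `K`-linear functional
on `L` to their coefficients turns them into conditions over `K` (`exists_ne_zero_of_eval_ne_zero`).
-/

namespace CrossSection

/-! ### Integral extensions away from a hypersurface -/

section IntegralAway

variable {A B : Type*} [CommRing A] [CommRing B]

/-- The ring homomorphism `g : A → B` becomes integral after inverting `c ∈ A`, expressed without
localizations: every `b ∈ B` has a multiple `g(c)ᵏ b` that is integral over `A`. -/
def IsIntegralAway (g : A →+* B) (c : A) : Prop :=
  ∀ b : B, ∃ k : ℕ, g.IsIntegralElem (g c ^ k * b)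

/-- Going up, and for `I = ⊥` lying over, for primes in the locus over which `g` is integral. -/
theorem IsIntegralAway.exists_ideal_over_prime {g : A →+* B} {c : A} (hg : IsIntegralAway g c)
    (q : Ideal A) [hq : q.IsPrime] (hc : c ∉ q) (I : Ideal B) (hI : I.comap g ≤ q) :
    ∃ Q ≥ I, Q.IsPrime ∧ Q.comap g = q := by
  let _ := g.toAlgebra
  let B' := integralClosure A B
  obtain ⟨Q', hIQ', hQ', hQ'q⟩ := Ideal.exists_ideal_over_prime_of_isIntegral (S := B') q
    (I.comap (algebraMap B' B)) (by
      rw [Ideal.comap_comap, ← IsScalarTower.algebraMap_eq]; exact hI)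
  let c' := algebraMap A B' c
  have hc' : c' ∉ Q' := fun h => hc (by rw [← hQ'q]; exact h)
  have hcg : (c' : B) = g c := rfl
  have hck : ∀ k, c' ^ k ∉ Q' := fun k h => hc' (hQ'.mem_of_pow_mem _ h)
  -- `Q` is the contraction to `B` of the extension of `Q'` to `B[1/c] = B'[1/c]`.
  let Q : Ideal B :=
    { carrier := {b | ∃ k : ℕ, ∃ y ∈ Q', (y : B) = g c ^ k * b}
      zero_mem' := ⟨0, 0, Q'.zero_mem, by simp⟩
      add_mem' := by
        rintro b₁ b₂ ⟨k₁, y₁, hy₁, h₁⟩ ⟨k₂, y₂, hy₂, h₂⟩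
        refine ⟨k₁ + k₂, c' ^ k₂ * y₁ + c' ^ k₁ * y₂,
          Q'.add_mem (Q'.mul_mem_left _ hy₁) (Q'.mul_mem_left _ hy₂), ?_⟩
        push_cast
        rw [h₁, h₂, hcg]
        ring
      smul_mem' := by
        rintro r b ⟨k₁, y₁, hy₁, h₁⟩
        obtain ⟨k, hk⟩ := hg r
        refine ⟨k + k₁, ⟨g c ^ k * r, hk⟩ * y₁, Q'.mul_mem_left _ hy₁, ?_⟩
        push_cast
        rw [h₁, smul_eq_mul]
        ring }
  refine ⟨Q, ?_, ⟨?_, ?_⟩, ?_⟩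
  · intro b hb
    obtain ⟨k, hk⟩ := hg b
    exact ⟨k, ⟨g c ^ k * b, hk⟩, hIQ' (Ideal.mem_comap.2 (I.mul_mem_left _ hb)), rfl⟩
  · rw [Ideal.ne_top_iff_one]
    rintro ⟨k, y, hy, h⟩
    refine hck k ?_
    rwa [show c' ^ k = y from Subtype.ext (by rw [h]; push_cast; rw [hcg, mul_one])]
  · rintro x y ⟨k, w, hw, h⟩
    obtain ⟨i, hi⟩ := hg x
    obtain ⟨j, hj⟩ := hg y
    have key : c' ^ k * ((⟨g c ^ i * x, hi⟩ : B') * ⟨g c ^ j * y, hj⟩) ∈ Q' := by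
      rw [show c' ^ k * ((⟨g c ^ i * x, hi⟩ : B') * ⟨g c ^ j * y, hj⟩) = c' ^ (i + j) * w from
        Subtype.ext (by push_cast; rw [h, hcg]; ring)]
      exact Q'.mul_mem_left _ hw
    rcases hQ'.mem_or_mem ((hQ'.mem_or_mem key).resolve_left (hck k)) with h | h
    · exact Or.inl ⟨i, _, h, rfl⟩
    · exact Or.inr ⟨j, _, h, rfl⟩
  · ext a
    constructor
    · rintro ⟨k, y, hy, h⟩
      have : algebraMap A B' (c ^ k * a) ∈ Q' := by
        rwa [show algebraMap A B' (c ^ k * a) = y from Subtype.ext (by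
          rw [h, ← map_pow, ← map_mul]; rfl)]
      rw [← Ideal.mem_comap, hQ'q] at this
      exact (hq.mem_or_mem this).resolve_left fun h => hc (hq.mem_of_pow_mem _ h)
    · intro ha
      rw [← hQ'q] at ha
      exact ⟨0, _, ha, by simp; rfl⟩

/-- Going up along an increasing sequence of primes. -/
theorem IsIntegralAway.exists_chain {g : A →+* B} {c : A} (hg : IsIntegralAway g c)
    (p : ℕ → Ideal A) (hp : ∀ k, (p k).IsPrime) (hmono : Monotone p) (hc : ∀ k, c ∉ p k)
    (hker : RingHom.ker g ≤ p 0) :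
    ∃ Q : ℕ → Ideal B, (∀ k, (Q k).IsPrime) ∧ Monotone Q ∧ ∀ k, (Q k).comap g = p k := by
  have h0 := hg.exists_ideal_over_prime (p 0) (hc 0) ⊥ hker
  have hs : ∀ k (Q : Ideal B), Q.comap g = p k →
      ∃ Q' ≥ Q, Q'.IsPrime ∧ Q'.comap g = p (k + 1) := fun k Q hQ =>
    hg.exists_ideal_over_prime (p (k + 1)) (hc _) Q (hQ.trans_le (hmono k.le_succ))
  choose F hF1 hF2 hF3 using hs
  choose Q0 _ hQ1 hQ2 using h0
  let Q : ∀ k, {Q : Ideal B // Q.IsPrime ∧ Q.comap g = p k} := fun k =>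
    Nat.rec ⟨Q0, hQ1, hQ2⟩ (fun k Q => ⟨F k Q.1 Q.2.2, hF2 _ _ _, hF3 _ _ _⟩) k
  exact ⟨fun k => (Q k).1, fun k => (Q k).2.1, monotone_nat_of_le_succ fun k => hF1 _ _ _,
    fun k => (Q k).2.2⟩

theorem ringKrullDim_le_of_isIntegral {g : A →+* B} (hg : g.IsIntegral) :
    ringKrullDim B ≤ ringKrullDim A := by
  algebraize [g]
  refine Order.krullDim_le_of_strictMono (PrimeSpectrum.comap (algebraMap A B)) fun P Q h => ?_
  exact Ideal.IsIntegral.comap_lt_comap h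

theorem ringKrullDim_eq_of_isIntegral {g : A →+* B} (hg : g.IsIntegral)
    (hinj : Function.Injective g) : ringKrullDim B = ringKrullDim A := by
  refine le_antisymm (ringKrullDim_le_of_isIntegral hg) ?_
  algebraize [g]
  refine iSup_le fun l => ?_
  have hker : RingHom.ker (algebraMap A B) = ⊥ := (RingHom.injective_iff_ker_eq_bot _).1 hinj
  obtain ⟨Q, -, hQ, hQ'⟩ := Ideal.exists_ideal_over_prime_of_isIntegral (S := B) l.head.asIdeal ⊥
    (by rw [← RingHom.ker_eq_comap_bot, hker]; exact bot_le)
  have : Q.LiesOver l.head.asIdeal := ⟨hQ'.symm⟩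
  obtain ⟨m, hm, -⟩ := Ideal.exists_ltSeries_of_hasGoingUp l Q
  rw [← hm]
  exact le_iSup (fun l : LTSeries (PrimeSpectrum B) => (l.length : WithBot ℕ∞)) m

/-- The fibres over primes in the locus over which `g` is integral have the expected dimension. -/
theorem IsIntegralAway.ringKrullDim_quotient_map {g : A →+* B} {c : A} (hg : IsIntegralAway g c)
    (hinj : Function.Injective g) (J : Ideal A) [J.IsPrime]
    (hc : IsUnit (Ideal.Quotient.mk J c)) :
    ringKrullDim (B ⧸ J.map g) = ringKrullDim (A ⧸ J) := by
  have hcJ : c ∉ J := fun h => by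
    rw [Ideal.Quotient.eq_zero_iff_mem.2 h] at hc
    exact not_isUnit_zero hc
  obtain ⟨Q, -, -, hQ⟩ := hg.exists_ideal_over_prime J hcJ ⊥
    (by rw [← RingHom.ker_eq_comap_bot, (RingHom.injective_iff_ker_eq_bot _).1 hinj]; exact bot_le)
  have hcomap : (J.map g).comap g ≤ J := by
    conv_rhs => rw [← hQ]
    exact Ideal.comap_mono (Ideal.map_le_iff_le_comap.2 hQ.ge)
  refine ringKrullDim_eq_of_isIntegral
    (g := Ideal.quotientMap (J.map g) g Ideal.le_comap_map) ?_
    (Ideal.quotientMap_injective' hcomap)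
  intro b
  obtain ⟨b, rfl⟩ := Ideal.Quotient.mk_surjective b
  obtain ⟨k, p, hp, hpb⟩ := hg b
  set φ := Ideal.quotientMap (J.map g) g Ideal.le_comap_map
  obtain ⟨u, hu⟩ := hc.exists_left_inv
  have h1 : φ.IsIntegralElem (Ideal.Quotient.mk (J.map g) (g c ^ k * b)) := by
    refine ⟨p.map (Ideal.Quotient.mk J), hp.map _, ?_⟩
    rw [Polynomial.eval₂_map, Ideal.quotientMap_comp_mk, ← Polynomial.hom_eval₂, hpb, map_zero]
  have h2 : φ.IsIntegralElem (φ (u ^ k)) := RingHom.isIntegralElem_map _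
  convert RingHom.IsIntegralElem.mul _ h2 h1 using 1
  have h3 : Ideal.Quotient.mk (J.map g) (g c) = φ (Ideal.Quotient.mk J c) := rfl
  rw [map_mul, map_pow (Ideal.Quotient.mk _), h3, ← map_pow φ, ← mul_assoc, ← map_mul, ← mul_pow,
    hu, one_pow, map_one, one_mul]

theorem isIntegralAway_of_adjoin {C : Type*} [CommRing C] [Algebra C B] {g : A →+* B} {c : A}
    (hC : ∀ r : C, ∃ a, g a = algebraMap C B r) {s : Set B} (hs : Algebra.adjoin C s = ⊤)
    (h : ∀ b ∈ s, ∃ k : ℕ, g.IsIntegralElem (g c ^ k * b)) : IsIntegralAway g c := by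
  have hpow : ∀ k : ℕ, g.IsIntegralElem (g c ^ k) := fun k => by
    rw [← map_pow]; exact RingHom.isIntegralElem_map _
  intro b
  have hb : b ∈ Algebra.adjoin C s := hs ▸ Algebra.mem_top
  induction hb using Algebra.adjoin_induction with
  | mem x hx => exact h x hx
  | algebraMap r =>
    obtain ⟨a, ha⟩ := hC r
    exact ⟨0, by rw [← ha, pow_zero, one_mul]; exact RingHom.isIntegralElem_map _⟩
  | add x y _ _ hx hy =>
    obtain ⟨i, hi⟩ := hx
    obtain ⟨j, hj⟩ := hy
    refine ⟨i + j, ?_⟩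
    convert RingHom.IsIntegralElem.add _ (RingHom.IsIntegralElem.mul _ (hpow j) hi)
      (RingHom.IsIntegralElem.mul _ (hpow i) hj) using 1
    ring
  | mul x y _ _ hx hy =>
    obtain ⟨i, hi⟩ := hx
    obtain ⟨j, hj⟩ := hy
    refine ⟨i + j, ?_⟩
    convert RingHom.IsIntegralElem.mul _ hi hj using 1
    ring

end IntegralAway

/-! ### Generic Noether normalization -/

open MvPolynomial in
/-- Noether normalization over a domain `C`, after inverting one nonzero element of `C`. -/
theorem exists_mvPolynomial_isIntegralAway (C B : Type*) [CommRing C] [IsDomain C] [CommRing B]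
    [Algebra C B] [Algebra.FiniteType C B] (hinj : Function.Injective (algebraMap C B)) :
    ∃ (e : ℕ) (g : MvPolynomial (Fin e) C →ₐ[C] B) (c : C), c ≠ 0 ∧ Function.Injective g ∧
      IsIntegralAway (g : MvPolynomial (Fin e) C →+* B) (MvPolynomial.C c) := by
  classical
  let F := FractionRing C
  let BF := F ⊗[C] B
  let M := nonZeroDivisors C
  have hnt : Nontrivial BF :=
    (Algebra.TensorProduct.includeLeft_injective (R := C) (S := C) (A := F) hinj).nontrivial
  let _ : Algebra B BF := Algebra.TensorProduct.rightAlgebra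
  have hloc : IsLocalization (Algebra.algebraMapSubmonoid B M) BF :=
    IsLocalization.tensorRight F M
  have hmapC : ∀ r : C, algebraMap B BF (algebraMap C B r) = algebraMap F BF (algebraMap C F r) :=
    fun r => by
      rw [← IsScalarTower.algebraMap_apply C F BF]
      exact (Algebra.TensorProduct.includeRight : B →ₐ[C] BF).commutes r
  obtain ⟨e, g₀, hg₀, hg₀int⟩ := exists_integral_inj_algHom_of_fg F BF
  -- Up to denominators from `C`, the parameters `g₀ Xᵢ` lie in `B`.
  have hw : ∀ i, ∃ (b : B) (c : F), c ≠ 0 ∧ algebraMap B BF b = c • g₀ (X i) := fun i => by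
    obtain ⟨⟨b, ⟨_, m, hm, rfl⟩⟩, h⟩ :=
      IsLocalization.surj (Algebra.algebraMapSubmonoid B M) (g₀ (X i))
    replace h : g₀ (X i) * algebraMap B BF (algebraMap C B m) = algebraMap B BF b := h
    refine ⟨b, algebraMap C F m, ?_, ?_⟩
    · exact (map_ne_zero_iff _ (IsFractionRing.injective C F)).2 (nonZeroDivisors.ne_zero hm)
    · rw [← h, mul_comm, hmapC]
      exact (Algebra.smul_def (A := BF) _ _).symm
  choose w cw hcw hw using hw
  let g : MvPolynomial (Fin e) C →ₐ[C] B := aeval w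
  let s : MvPolynomial (Fin e) F →ₐ[F] MvPolynomial (Fin e) F := aeval fun i => cw i • X i
  let s' : MvPolynomial (Fin e) F →ₐ[F] MvPolynomial (Fin e) F := aeval fun i => (cw i)⁻¹ • X i
  have hs's : s'.comp s = AlgHom.id F _ := by
    ext1 i
    simp [s, s', smul_smul, mul_inv_cancel₀ (hcw i)]
  have hss' : s.comp s' = AlgHom.id F _ := by
    ext1 i
    simp [s, s', smul_smul, inv_mul_cancel₀ (hcw i)]
  have hs_inj : Function.Injective s :=
    Function.LeftInverse.injective (g := s') fun x => DFunLike.congr_fun hs's x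
  have hs_surj : Function.Surjective s := fun x => ⟨s' x, DFunLike.congr_fun hss' x⟩
  have key : ∀ p, algebraMap B BF (g p) = g₀ (s (map (algebraMap C F) p)) := fun p => by
    induction p using MvPolynomial.induction_on with
    | C r =>
      rw [map_C, ← algebraMap_eq, AlgHom.commutes, ← algebraMap_eq, AlgHom.commutes,
        AlgHom.commutes, hmapC]
    | add p q hp hq => simp only [map_add, hp, hq]
    | mul_X p i hp => simp only [map_mul, hp, map_X, g, s, aeval_X, hw, map_smul]
  have hg_inj : Function.Injective g := by
    rw [injective_iff_map_eq_zero]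
    intro p hp
    have h := key p
    rw [hp, map_zero] at h
    exact map_injective _ (IsFractionRing.injective C F)
      ((hg₀.comp hs_inj) (by simpa using h.symm))
  have hgF_int : (g₀.toRingHom.comp s.toRingHom).IsIntegral :=
    RingHom.IsIntegral.trans _ _ (RingHom.isIntegral_of_surjective _ hs_surj) hg₀int
  have hb : ∀ b : B, ∃ c : C, c ≠ 0 ∧ (g : MvPolynomial (Fin e) C →+* B).IsIntegralElem
      (algebraMap C B c * b) := by
    intro b
    let _ : Algebra (MvPolynomial (Fin e) C) (MvPolynomial (Fin e) F) :=
      MvPolynomial.algebraMvPolynomial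
    let _ : Algebra (MvPolynomial (Fin e) C) B := g.toRingHom.toAlgebra
    let _ : Algebra (MvPolynomial (Fin e) C) BF := ((algebraMap B BF).comp g.toRingHom).toAlgebra
    let _ : Algebra (MvPolynomial (Fin e) F) BF := (g₀.toRingHom.comp s.toRingHom).toAlgebra
    have : IsScalarTower (MvPolynomial (Fin e) C) B BF := IsScalarTower.of_algebraMap_eq' rfl
    have : IsScalarTower (MvPolynomial (Fin e) C) (MvPolynomial (Fin e) F) BF :=
      IsScalarTower.of_algebraMap_eq key
    have hc : ∀ r, algebraMap (MvPolynomial (Fin e) C) B (MvPolynomial.C r) = algebraMap C B r :=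
      fun r => g.commutes r
    have hMM : Algebra.algebraMapSubmonoid B
        (M.map (MvPolynomial.C : C →+* MvPolynomial (Fin e) C)) =
        Algebra.algebraMapSubmonoid B M := by
      ext x
      simp [Algebra.algebraMapSubmonoid, Submonoid.mem_map, hc]
    have : IsLocalization (Algebra.algebraMapSubmonoid B
        (M.map (MvPolynomial.C : C →+* MvPolynomial (Fin e) C))) BF := hMM ▸ hloc
    obtain ⟨⟨_, m, hm, rfl⟩, hmb⟩ := IsIntegral.exists_multiple_integral_of_isLocalization
      (M.map (MvPolynomial.C : C →+* MvPolynomial (Fin e) C)) (Rₘ := MvPolynomial (Fin e) F)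
      (algebraMap B BF b) (hgF_int _)
    rw [Submonoid.smul_def, Algebra.smul_def, IsScalarTower.algebraMap_apply _ B BF,
      ← map_mul] at hmb
    obtain ⟨_, ⟨m', hm', rfl⟩, hmb'⟩ := IsLocalization.exists_isIntegral_smul_of_isIntegral_map
      (M.map (MvPolynomial.C : C →+* MvPolynomial (Fin e) C)) hmb
    refine ⟨m' * m, mul_ne_zero (nonZeroDivisors.ne_zero hm') (nonZeroDivisors.ne_zero hm), ?_⟩
    rw [Algebra.smul_def, ← mul_assoc] at hmb'
    replace hmb' : IsIntegral (MvPolynomial (Fin e) C)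
      (algebraMap (MvPolynomial (Fin e) C) B (MvPolynomial.C m') *
        algebraMap (MvPolynomial (Fin e) C) B (MvPolynomial.C m) * b) := hmb'
    rwa [hc, hc, ← map_mul] at hmb'
  choose cb hcb hcb' using hb
  obtain ⟨t, ht⟩ := Algebra.FiniteType.out (R := C) (A := B)
  refine ⟨e, g, ∏ b ∈ t, cb b, Finset.prod_ne_zero_iff.2 fun b _ => hcb b, hg_inj, ?_⟩
  refine isIntegralAway_of_adjoin (C := C) (s := t) (fun r => ⟨MvPolynomial.C r, ?_⟩) ht ?_
  · rw [← algebraMap_eq]; exact g.commutes r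
  · intro b hb
    refine ⟨1, ?_⟩
    rw [pow_one, ← Finset.mul_prod_erase t cb hb, ← algebraMap_eq, RingHom.coe_coe, g.commutes,
      map_mul, mul_right_comm, mul_comm]
    refine RingHom.IsIntegralElem.mul _ ?_ (hcb' b)
    rw [← g.commutes]
    exact RingHom.isIntegralElem_map _

/-! ### Points, extension of scalars and transcendence degree -/

section PointsAndDomains

variable {K : Type*} [Field K] [IsAlgClosed K] {B : Type*} [CommRing B] [Algebra K B]
  [Algebra.FiniteType K B]

/-- Hilbert's Nullstellensatz: a radical ideal is cut out by the `K`-points on which it vanishes. -/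
theorem exists_algHom_ne_zero {I : Ideal B} (hI : I.IsRadical) {u : B} (hu : u ∉ I) :
    ∃ φ : B →ₐ[K] K, I ≤ RingHom.ker φ ∧ φ u ≠ 0 := by
  have : IsJacobsonRing B := isJacobsonRing_of_finiteType (A := K)
  rw [← IsJacobsonRing.out this hI, Ideal.jacobson, Submodule.mem_sInf] at hu
  push Not at hu
  obtain ⟨m, ⟨hIm, hm⟩, hum⟩ := hu
  let _ : Field (B ⧸ m) := Ideal.Quotient.field m
  have : Module.Finite K (B ⧸ m) := finite_of_finite_type_of_isJacobsonRing K (B ⧸ m)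
  let e : K ≃ₐ[K] (B ⧸ m) := AlgEquiv.ofBijective (Algebra.ofId K (B ⧸ m))
    IsAlgClosed.algebraMap_bijective_of_isIntegral
  have he : ∀ b, ((e.symm : (B ⧸ m) →ₐ[K] K).comp (Ideal.Quotient.mkₐ K m)) b = 0 ↔ b ∈ m :=
    fun b => by
      rw [← Ideal.Quotient.eq_zero_iff_mem]
      exact e.symm.map_eq_zero_iff
  exact ⟨(e.symm : (B ⧸ m) →ₐ[K] K).comp (Ideal.Quotient.mkₐ K m),
    fun b hb => (he b).2 (hIm hb), fun h => hum ((he u).1 h)⟩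

/-- Evaluation of the second factor of `L ⊗ B` at a `K`-point of `B`. -/
def evalRight {K : Type*} [Field K] (L : Type*) [Field L] [Algebra K L] {B : Type*} [CommRing B]
    [Algebra K B] (φ : B →ₐ[K] K) : L ⊗[K] B →ₐ[L] L :=
  Algebra.TensorProduct.lift (AlgHom.id L L) ((Algebra.ofId K L).comp φ) fun _ _ => Commute.all _ _

/-- A nonzero element of `L ⊗ B` is nonzero at the `K`-points of a nonempty open set: take one of
its coordinates with respect to a basis of `L` over `K`. -/
theorem exists_forall_evalRight_ne_zero {K : Type*} [Field K] {L : Type*} [Field L] [Algebra K L]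
    {B : Type*} [CommRing B] [Algebra K B] {z : L ⊗[K] B} (hz : z ≠ 0) :
    ∃ u : B, u ≠ 0 ∧ ∀ φ : B →ₐ[K] K, φ u ≠ 0 → evalRight L φ z ≠ 0 := by
  let b := Module.Basis.ofVectorSpace K L
  obtain ⟨c, rfl⟩ := TensorProduct.eq_repr_basis_left b z
  have hc : c ≠ 0 := by
    rintro rfl
    simp at hz
  obtain ⟨i, hi⟩ := Finsupp.ne_iff.1 hc
  refine ⟨c i, hi, fun φ hφ h0 => hφ ?_⟩
  have h1 : ∑ j ∈ c.support, φ (c j) • b j = 0 := by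
    simpa [Finsupp.sum, evalRight, Algebra.ofId_apply, Algebra.smul_def, mul_comm] using h0
  exact linearIndependent_iff'.1 b.linearIndependent _ _ h1 i (Finsupp.mem_support_iff.2 hi)

/-- Domains over an algebraically closed field stay domains under extension of scalars: the product
of two nonzero elements is nonzero after evaluation at a suitable `K`-point of `B`. -/
theorem isDomain_tensor (L : Type*) [Field L] [Algebra K L] [IsDomain B] :
    IsDomain (L ⊗[K] B) := by
  have hnt : Nontrivial (L ⊗[K] B) :=
    (Algebra.TensorProduct.includeLeft_injective (R := K) (S := K) (A := L)
      (algebraMap K B).injective).nontrivial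
  have : NoZeroDivisors (L ⊗[K] B) := by
    refine ⟨fun {x y} hxy => ?_⟩
    by_contra! h
    obtain ⟨u, hu, hu'⟩ := exists_forall_evalRight_ne_zero h.1
    obtain ⟨v, hv, hv'⟩ := exists_forall_evalRight_ne_zero h.2
    obtain ⟨φ, -, hφ⟩ := exists_algHom_ne_zero (K := K) (I := (⊥ : Ideal B))
      (Ideal.isPrime_bot.isRadical) (u := u * v) (by simpa using mul_ne_zero hu hv)
    rw [map_mul] at hφ
    refine mul_ne_zero (hu' φ (left_ne_zero_of_mul hφ)) (hv' φ (right_ne_zero_of_mul hφ)) ?_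
    rw [← map_mul, hxy, map_zero]
  exact (isDomain_iff_noZeroDivisors_and_nontrivial _).2 ⟨this, hnt⟩

end PointsAndDomains

section AlgebraicIndependence

theorem algebraicIndependent_tmul {K : Type*} [Field K] (κ : Type*) [Field κ] [Algebra K κ]
    {B : Type*} [CommRing B] [Algebra K B] {ι : Type*} {t : ι → B} (ht : AlgebraicIndependent K t) :
    AlgebraicIndependent κ fun i => (1 : κ) ⊗ₜ[K] t i := by
  have h1 : Function.Injective (Algebra.TensorProduct.map (AlgHom.id κ κ)
      (MvPolynomial.aeval t : MvPolynomial ι K →ₐ[K] B)) :=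
    Module.Flat.lTensor_preserves_injective_linearMap (M := κ)
      (MvPolynomial.aeval t : MvPolynomial ι K →ₐ[K] B).toLinearMap ht
  have h2 : (MvPolynomial.aeval fun i => (1 : κ) ⊗ₜ[K] t i) =
      (Algebra.TensorProduct.map (AlgHom.id κ κ) (MvPolynomial.aeval t)).comp
        (MvPolynomial.algebraTensorAlgEquiv (σ := ι) K κ).symm.toAlgHom := by
    ext i
    simp
  rw [AlgebraicIndependent, h2]
  exact h1.comp (MvPolynomial.algebraTensorAlgEquiv (σ := ι) K κ).symm.injective

/-- An algebraically independent family stays so on some irreducible component. -/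
theorem exists_prime_algebraicIndependent {L S : Type*} [Field L] [CommRing S] [Algebra L S]
    {ι : Type*} {t : ι → S} (ht : AlgebraicIndependent L t) :
    ∃ P : Ideal S, P.IsPrime ∧ AlgebraicIndependent L fun i => Ideal.Quotient.mk P (t i) := by
  obtain ⟨P, hP, hPt⟩ := Ideal.exists_comap_eq_of_mem_minimalPrimes_of_injective
    (f := (MvPolynomial.aeval t : MvPolynomial ι L →ₐ[L] S).toRingHom) ht ⊥
    (by rw [IsDomain.minimalPrimes_eq_singleton_bot]; rfl)
  refine ⟨P, hP, (injective_iff_map_eq_zero _).2 fun p hp => ?_⟩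
  rw [← Ideal.mem_bot, ← hPt, Ideal.mem_comap, ← Ideal.Quotient.eq_zero_iff_mem, ← hp]
  exact MvPolynomial.comp_aeval_apply t (Ideal.Quotient.mkₐ L P) p

/-- A domain that is generically integral over a ring with generators `v` has transcendence degree
at most the number of these generators. -/
theorem card_le_card_of_isIntegralAway {L S A ι κ : Type*} [Field L] [CommRing S] [IsDomain S]
    [Algebra L S] [CommRing A] [Algebra L A] [Fintype ι] [Fintype κ] {v : κ → A}
    (hv : Algebra.adjoin L (Set.range v) = ⊤) (g : A →ₐ[L] S) {c : A} (hc : g c ≠ 0)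
    (hg : IsIntegralAway (g : A →+* S) c) {t : ι → S} (ht : AlgebraicIndependent L t) :
    Fintype.card ι ≤ Fintype.card κ := by
  have hrange : Algebra.adjoin L (Set.range (g ∘ v)) = g.range := by
    rw [Set.range_comp, Algebra.adjoin_image, hv, Algebra.map_top]
  have halg : Algebra.IsAlgebraic (Algebra.adjoin L (Set.range (g ∘ v))) S := by
    rw [hrange]
    refine ⟨fun b => ?_⟩
    obtain ⟨k, hk⟩ := hg b
    have h1 : IsIntegral g.range (g c ^ k * b) := by
      obtain ⟨p, hp, hpb⟩ := hk
      refine ⟨p.map g.rangeRestrict.toRingHom, hp.map _, ?_⟩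
      rw [Polynomial.eval₂_map]
      exact hpb
    refine IsAlgebraic.of_mul (mem_nonZeroDivisors_of_ne_zero (pow_ne_zero k hc)) ?_
      h1.isAlgebraic
    have : g c ^ k = algebraMap g.range S (⟨g c, c, rfl⟩ ^ k) := by simp
    rw [this]
    exact isAlgebraic_algebraMap _
  have h2 := Algebra.IsAlgebraic.trdeg_le_cardinalMk L (Set.range (g ∘ v))
  have h3 := ht.lift_cardinalMk_le_trdeg
  have h4 : Cardinal.mk (Set.range (g ∘ v)) ≤ (Fintype.card κ : Cardinal) := by
    rw [← Set.cast_ncard (Set.finite_range _), ← Nat.card_coe_set_eq]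
    exact Nat.cast_le.2 ((Finite.card_range_le _).trans_eq Nat.card_eq_fintype_card)
  have h5 := h3.trans (Cardinal.lift_le.2 (h2.trans h4))
  simpa using h5

theorem card_le_of_isIntegral {L S ι : Type*} [Field L] [CommRing S] [Algebra L S] [Fintype ι]
    {N : ℕ} (g : MvPolynomial (Fin N) L →ₐ[L] S)
    (hg : (g : MvPolynomial (Fin N) L →+* S).IsIntegral)
    {t : ι → S} (ht : AlgebraicIndependent L t) : Fintype.card ι ≤ N := by
  obtain ⟨P, hP, hPt⟩ := exists_prime_algebraicIndependent ht
  rw [← Fintype.card_fin N]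
  refine card_le_card_of_isIntegralAway (MvPolynomial.adjoin_range_X)
    ((Ideal.Quotient.mkₐ L P).comp g) (c := 1) (by simp) (fun b => ⟨0, ?_⟩) hPt
  obtain ⟨b, rfl⟩ := Ideal.Quotient.mk_surjective b
  obtain ⟨p, hp, hpb⟩ := hg b
  refine ⟨p, hp, ?_⟩
  rw [pow_zero, one_mul]
  have := congrArg (Ideal.Quotient.mk P) hpb
  rwa [Polynomial.hom_eval₂, map_zero] at this

end AlgebraicIndependence

/-! ### Dimension of the general fibre -/

open MvPolynomial in
/-- Dimension of the general fibre. Let `t` be `d` algebraically independent elements of a finitely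
generated `L`-algebra `S` of dimension at most `N`, such that every nonempty open subset of `Spec S`
meets an integral closed subscheme of dimension at least `N` (`hopen`). Away from a hypersurface,
the fibres of `t` over `L`-points have dimension `N - d`. -/
theorem exists_ringKrullDim_fibre {L S : Type*} [Field L] [CommRing S] [Algebra L S]
    [Algebra.FiniteType L S] {d N : ℕ} {t : Fin d → S} (ht : AlgebraicIndependent L t)
    (gN : MvPolynomial (Fin N) L →ₐ[L] S) (hgN : (gN : MvPolynomial (Fin N) L →+* S).IsIntegral)
    (hopen : ∀ h : S, h ≠ 0 → ∃ P : Ideal S, P.IsPrime ∧ h ∉ P ∧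
      ∃ s : Fin N → S, AlgebraicIndependent L fun i => Ideal.Quotient.mk P (s i)) :
    ∃ h : MvPolynomial (Fin d) L, h ≠ 0 ∧ ∀ β : Fin d → L, eval β h ≠ 0 →
      ringKrullDim (S ⧸ Ideal.span (Set.range fun i => t i - algebraMap L S (β i))) +
        (d : WithBot ℕ∞) = N := by
  let _ : Algebra (MvPolynomial (Fin d) L) S := (aeval t : _ →ₐ[L] S).toRingHom.toAlgebra
  have hmap : ∀ p, algebraMap (MvPolynomial (Fin d) L) S p = aeval t p := fun _ => rfl
  have : IsScalarTower L (MvPolynomial (Fin d) L) S :=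
    IsScalarTower.of_algebraMap_eq fun r => by
      rw [hmap, algebraMap_eq, aeval_C]
  have : Algebra.FiniteType (MvPolynomial (Fin d) L) S :=
    Algebra.FiniteType.of_restrictScalars_finiteType L _ S
  obtain ⟨e, g, h, hh, hg_inj, hg⟩ := exists_mvPolynomial_isIntegralAway
    (MvPolynomial (Fin d) L) S ht
  have hgC : ∀ p, g (C p) = aeval t p := fun p => g.commutes p
  -- `S` is generically integral over a polynomial ring in `d + e` variables, whence `d + e = N`.
  let G : MvPolynomial (Fin e ⊕ Fin d) L →ₐ[L] S :=
    (g.restrictScalars L).comp (sumAlgEquiv L (Fin e) (Fin d)).toAlgHom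
  have hG : AlgebraicIndependent L (G ∘ X) :=
    (algebraicIndependent_X _ L).map' (hg_inj.comp (sumAlgEquiv L (Fin e) (Fin d)).injective)
  have hle : Fintype.card (Fin e ⊕ Fin d) ≤ N := card_le_of_isIntegral gN hgN hG
  obtain ⟨P, hP, hhP, s, hs⟩ := hopen (aeval t h) ((map_ne_zero_iff _ ht).2 hh)
  have hge : Fintype.card (Fin N) ≤ Fintype.card (Fin e ⊕ Fin d) := by
    refine card_le_card_of_isIntegralAway (A := MvPolynomial (Fin e) (MvPolynomial (Fin d) L))
      (v := sumAlgEquiv L (Fin e) (Fin d) ∘ X) ?_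
      ((Ideal.Quotient.mkₐ L P).comp (g.restrictScalars L)) (c := C h) ?_ (fun b => ?_) hs
    · rw [Set.range_comp, ← AlgEquiv.coe_toAlgHom, Algebra.adjoin_image, adjoin_range_X,
        Algebra.map_top, AlgHom.range_eq_top]
      exact (sumAlgEquiv L (Fin e) (Fin d)).surjective
    · intro h0
      refine hhP (Ideal.Quotient.eq_zero_iff_mem.1 ?_)
      rw [← hgC]
      exact h0
    · obtain ⟨b, rfl⟩ := Ideal.Quotient.mk_surjective b
      obtain ⟨k, p, hp, hpb⟩ := hg b
      refine ⟨k, p, hp, ?_⟩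
      have := congrArg (Ideal.Quotient.mk P) hpb
      rw [Polynomial.hom_eval₂, map_zero, map_mul, map_pow] at this
      exact this
  simp only [Fintype.card_sum, Fintype.card_fin] at hle hge
  refine ⟨h, hh, fun β hβ => ?_⟩
  let ev : MvPolynomial (Fin e) (MvPolynomial (Fin d) L) →+* MvPolynomial (Fin e) L := map (eval β)
  have hev : Function.Surjective ev := map_surjective _ fun r => ⟨C r, eval_C r⟩
  set I : Ideal S := Ideal.span (Set.range fun i => t i - algebraMap L S (β i))
  -- The fibre is the base change of `g` along the evaluation at `β`.
  have hI : (RingHom.ker ev).map (g : MvPolynomial (Fin e) (MvPolynomial (Fin d) L) →+* S) = I := by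
    refine le_antisymm ?_ (Ideal.span_le.2 ?_)
    · rw [Ideal.map_le_iff_le_comap]
      intro p hp
      have key : (Ideal.Quotient.mk I).comp
          (g : MvPolynomial (Fin e) (MvPolynomial (Fin d) L) →+* S) =
          (aeval fun i => Ideal.Quotient.mk I (g (X i)) :
            MvPolynomial (Fin e) L →ₐ[L] S ⧸ I).toRingHom.comp ev := by
        refine ringHom_ext' (ringHom_ext' ?_ fun i => ?_) fun i => ?_
        · ext r
          simp [ev, hgC]
        · have : t i - algebraMap L S (β i) ∈ I := Ideal.subset_span ⟨i, rfl⟩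
          simpa [ev, hgC] using! Ideal.Quotient.eq.2 this
        · simp [ev]
      rw [Ideal.mem_comap, ← Ideal.Quotient.eq_zero_iff_mem]
      refine (DFunLike.congr_fun key p).trans ?_
      rw [RingHom.comp_apply, (RingHom.mem_ker).1 hp, map_zero]
    · rintro _ ⟨i, rfl⟩
      have : C (X i - C (β i)) ∈ RingHom.ker ev := by simp [RingHom.mem_ker, ev]
      convert Ideal.mem_map_of_mem (g : MvPolynomial (Fin e) (MvPolynomial (Fin d) L) →+* S) this
      simp [hgC]
  have hprime : (RingHom.ker ev).IsPrime := RingHom.ker_isPrime ev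
  have hunit : IsUnit (Ideal.Quotient.mk (RingHom.ker ev) (C h)) := by
    refine isUnit_iff_exists_inv.2 ⟨Ideal.Quotient.mk _ (C (C (eval β h)⁻¹)), ?_⟩
    rw [← map_mul, ← map_one (Ideal.Quotient.mk _), Ideal.Quotient.eq, RingHom.mem_ker]
    simp only [ev, map_sub, map_mul, map_C, eval_C, map_one]
    rw [← map_mul, mul_inv_cancel₀ hβ, map_one, sub_self]
  have hdim := hg.ringKrullDim_quotient_map hg_inj (RingHom.ker ev) hunit
  rw [hI, ringKrullDim_eq_of_ringEquiv (R := _ ⧸ RingHom.ker ev)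
    (RingHom.quotientKerEquivOfSurjective hev), ringKrullDim_of_isNoetherianRing,
    ringKrullDim_eq_zero_of_field, Nat.card_fin] at hdim
  rw [hdim, zero_add, ← Nat.cast_add, le_antisymm hle hge]

/-! ### Zariski topology and prime ideals -/

section InducedTopology

variable {K : Type*} [Field K] {X : Type*} [AffineVariety K X] {T : Type*} (ι : T → X)

/-- The regular functions on `X` that vanish on the image of `Z ⊆ T` under `ι : T → X`. -/
def vanishingIdealOn (Z : Set T) : Ideal (CoordRing K X) where
  carrier := {f | ∀ y ∈ Z, f.1 (ι y) = 0}
  zero_mem' := fun _ _ => rfl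
  add_mem' := fun {f g} hf hg y hy => by
    change f.1 (ι y) + g.1 (ι y) = 0
    rw [hf y hy, hg y hy, add_zero]
  smul_mem' := fun c f hf y hy => by
    change c.1 (ι y) * f.1 (ι y) = 0
    rw [hf y hy, mul_zero]

/-- The points of `T` whose image in `X` lies in the zero set of the ideal `p`. -/
def zeroLocusOn (p : Ideal (CoordRing K X)) : Set T :=
  {y | ∀ f ∈ p, f.1 (ι y) = 0}

theorem mem_zeroLocusOn {p : Ideal (CoordRing K X)} {y : T} :
    y ∈ zeroLocusOn ι p ↔ ∀ f ∈ p, f.1 (ι y) = 0 := Iff.rfl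

theorem isClosed_induced_zariski_iff {Z : Set T} :
    @IsClosed _ ((zariski K X).induced ι) Z ↔
      zeroLocusOn ι (vanishingIdealOn (K := K) ι Z) = Z := by
  have hcl : ∀ W : Set X, @IsClosed _ (zariski K X) W ↔ ∃ S : Set (CoordRing K X), W = zeros S := by
    intro W
    rw [← @isOpen_compl_iff _ _ (zariski K X)]
    change Wᶜᶜ ∈ {Z | ∃ S : Set (CoordRing K X), Z = zeros S} ↔ _
    rw [compl_compl]
    rfl
  rw [@isClosed_induced_iff _ _ (zariski K X)]
  constructor
  · rintro ⟨W, hW, rfl⟩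
    obtain ⟨S, rfl⟩ := (hcl W).1 hW
    refine Set.Subset.antisymm (fun y hy f hf => hy f fun z hz => hz f hf) ?_
    exact fun y hy f hf => hf y hy
  · intro h
    exact ⟨zeros (vanishingIdealOn (K := K) ι Z : Set (CoordRing K X)), (hcl _).2 ⟨_, rfl⟩, h⟩

theorem isIrreducible_induced_zariski_iff {Z : Set T} :
    @IsIrreducible _ ((zariski K X).induced ι) Z ↔ (vanishingIdealOn (K := K) ι Z).IsPrime := by
  let _ := (zariski K X).induced ι
  have hcl : ∀ p : Ideal (CoordRing K X), IsClosed (zeroLocusOn ι p) := fun p => by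
    rw [isClosed_induced_zariski_iff (K := K)]
    refine Set.Subset.antisymm (fun y hy f hf => hy f fun z hz => hz f hf) ?_
    exact fun y hy f hf => hf y hy
  constructor
  · rintro ⟨⟨z, hz⟩, hirr⟩
    refine ⟨(Ideal.ne_top_iff_one _).2 fun h => one_ne_zero (h z hz), fun {f g} hfg => ?_⟩
    refine (isPreirreducible_iff_isClosed_union_isClosed.1 hirr _ _ (hcl (Ideal.span {f}))
      (hcl (Ideal.span {g})) fun y hy => ?_).imp (fun h y hy => ?_) (fun h y hy => ?_)
    · refine (mul_eq_zero.1 (hfg y hy)).imp (fun h u hu => ?_) (fun h u hu => ?_)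
      all_goals
        obtain ⟨v, rfl⟩ := Ideal.mem_span_singleton'.1 hu
        exact mul_eq_zero_of_right _ h
    · exact h hy f (Ideal.mem_span_singleton_self f)
    · exact h hy g (Ideal.mem_span_singleton_self g)
  · intro hp
    refine ⟨?_, isPreirreducible_iff_isClosed_union_isClosed.2 fun Z₁ Z₂ h₁ h₂ h => ?_⟩
    · by_contra hne
      refine hp.ne_top ((Ideal.eq_top_iff_one _).2 fun y hy => ?_)
      exact absurd ⟨y, hy⟩ hne
    · by_contra! hcon
      obtain ⟨⟨y, hyZ, hy⟩, ⟨z, hzZ, hz⟩⟩ := hcon.imp Set.not_subset.1 Set.not_subset.1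
      rw [← (isClosed_induced_zariski_iff (K := K) ι).1 h₁, mem_zeroLocusOn] at hy
      rw [← (isClosed_induced_zariski_iff (K := K) ι).1 h₂, mem_zeroLocusOn] at hz
      push Not at hy hz
      obtain ⟨f, hf, hfy⟩ := hy
      obtain ⟨g, hg, hgz⟩ := hz
      have hfg : f * g ∈ vanishingIdealOn ι Z := fun w hw => by
        change f.1 (ι w) * g.1 (ι w) = 0
        exact (h hw).elim (fun h => mul_eq_zero_of_left (hf w h) _)
          fun h => mul_eq_zero_of_right _ (hg w h)
      exact (hp.mem_or_mem hfg).elim (fun h => hfy (h y hyZ)) fun h => hgz (h z hzZ)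

/-- Irreducible closed subsets of `T` correspond to the primes of `K[X]` that are the vanishing
ideals of their zero loci in `T`. -/
theorem topologicalKrullDim_induced_zariski :
    @topologicalKrullDim T ((zariski K X).induced ι) =
      Order.krullDim {p : PrimeSpectrum (CoordRing K X) //
        vanishingIdealOn ι (zeroLocusOn ι p.asIdeal) = p.asIdeal} := by
  let _ := (zariski K X).induced ι
  have hmono : ∀ {Z W : Set T}, Z ⊆ W → vanishingIdealOn (K := K) ι W ≤ vanishingIdealOn ι Z :=
    fun h f hf y hy => hf y (h hy)
  have hmono' : ∀ {p q : Ideal (CoordRing K X)}, p ≤ q → zeroLocusOn ι q ⊆ zeroLocusOn ι p :=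
    fun h y hy f hf => hy f (h hf)
  have hclosed : ∀ Z : TopologicalSpace.IrreducibleCloseds T,
      zeroLocusOn ι (vanishingIdealOn (K := K) ι (Z : Set T)) = Z := fun Z =>
    (isClosed_induced_zariski_iff (K := K) ι).1 Z.isClosed
  let e : TopologicalSpace.IrreducibleCloseds T ≃o {p : PrimeSpectrum (CoordRing K X) //
        vanishingIdealOn ι (zeroLocusOn ι p.asIdeal) = p.asIdeal}ᵒᵈ :=
    { toFun := fun Z => OrderDual.toDual
        ⟨⟨vanishingIdealOn ι Z, (isIrreducible_induced_zariski_iff ι).1 Z.isIrreducible⟩,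
          congrArg _ (hclosed Z)⟩
      invFun := fun p =>
        have hcl : IsClosed (zeroLocusOn ι (OrderDual.ofDual p).1.asIdeal) :=
          (isClosed_induced_zariski_iff (K := K) ι).2 (congrArg _ (OrderDual.ofDual p).2)
        ⟨zeroLocusOn ι (OrderDual.ofDual p).1.asIdeal,
          (isIrreducible_induced_zariski_iff (K := K) ι).2
            ((OrderDual.ofDual p).2.symm ▸ (OrderDual.ofDual p).1.2), hcl⟩
      left_inv := fun Z => TopologicalSpace.IrreducibleCloseds.ext (hclosed Z)
      right_inv := fun p => OrderDual.ofDual.injective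
        (Subtype.ext (PrimeSpectrum.ext (OrderDual.ofDual p).2))
      map_rel_iff' := fun {Z W} => by
        refine ⟨fun h => ?_, fun h => hmono h⟩
        have := hmono' (show vanishingIdealOn (K := K) ι (W : Set T) ≤ vanishingIdealOn ι Z from h)
        rwa [hclosed, hclosed] at this }
  rw [topologicalKrullDim, Order.krullDim_eq_of_orderIso e, Order.krullDim_orderDual]

end InducedTopology

section Points

variable {K : Type*} [Field K] {X : Type*} [AffineVariety K X]

instance finiteType_coordRing : Algebra.FiniteType K (CoordRing K X) :=
  (Subalgebra.fg_iff_finiteType _).1 AffineVariety.regular_fg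

theorem exists_point_ne_zero [IsAlgClosed K] {I : Ideal (CoordRing K X)} (hI : I.IsRadical)
    {f : CoordRing K X} (hf : f ∉ I) : ∃ x : X, (∀ h ∈ I, h.1 x = 0) ∧ f.1 x ≠ 0 := by
  obtain ⟨φ, hφ, hφf⟩ := exists_algHom_ne_zero (K := K) hI hf
  obtain ⟨x, hx, -⟩ := AffineVariety.existsUnique_point φ
  exact ⟨x, fun h hh => (hx h).symm.trans (hφ hh), fun h0 => hφf ((hx f).trans h0)⟩

theorem dimVariety_eq_ringKrullDim [IsAlgClosed K] :
    dimVariety K X = ringKrullDim (CoordRing K X) := by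
  have h := topologicalKrullDim_induced_zariski (K := K) (id : X → X)
  rw [@induced_id _ (zariski K X)] at h
  rw [dimVariety, h, ringKrullDim]
  refine Order.krullDim_eq_of_orderIso ((OrderIso.setCongr _ Set.univ ?_).trans OrderIso.Set.univ)
  refine Set.eq_univ_of_forall fun p => ?_
  refine le_antisymm (fun f hf => ?_) fun f hf x hx => hx f hf
  by_contra hfp
  obtain ⟨x, hx, hfx⟩ := exists_point_ne_zero p.2.isRadical hfp
  exact hfx (hf x hx)

end Points

/-! ### Dimension of orbits -/

/-- Algebraic independence can be tested after passing to a further quotient. -/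
theorem algebraicIndependent_of_ker_le {R A B D : Type*} [CommRing R] [CommRing A] [CommRing B]
    [CommRing D] [Algebra R A] [Algebra R B] [Algebra R D] (f : A →ₐ[R] B) (g : A →ₐ[R] D)
    (h : ∀ x, f x = 0 → g x = 0) {ι : Type*} {a : ι → A}
    (ha : AlgebraicIndependent R fun i => g (a i)) : AlgebraicIndependent R fun i => f (a i) := by
  refine (injective_iff_map_eq_zero _).2 fun F hF => (injective_iff_map_eq_zero _).1 ha F ?_
  rw [← MvPolynomial.comp_aeval_apply a g]
  exact h _ ((MvPolynomial.comp_aeval_apply a f F).trans hF)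

/-- A domain generated by the family `a` contains a subfamily of `a` of length `r` that is
algebraically independent as soon as its Krull dimension is at least `r`. -/
theorem exists_algebraicIndependent_of_le_ringKrullDim {K D : Type*} [Field K] [CommRing D]
    [IsDomain D] [Algebra K D] {n : ℕ} {a : Fin n → D}
    (ha : Algebra.adjoin K (Set.range a) = ⊤) {r : ℕ}
    (hr : (r : WithBot ℕ∞) ≤ ringKrullDim D) :
    ∃ i : Fin r → Fin n, AlgebraicIndependent K fun j => a (i j) := by
  have hfg : Algebra.FiniteType K D := by
    refine ⟨?_⟩
    rw [← ha, ← Set.Finite.coe_toFinset (Set.finite_range a)]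
    exact Subalgebra.fg_adjoin_finset _
  obtain ⟨e, g, hg, hgint⟩ := exists_integral_inj_algHom_of_fg K D
  have he : r ≤ e := by
    rw [ringKrullDim_eq_of_isIntegral hgint hg, MvPolynomial.ringKrullDim_of_isNoetherianRing,
      ringKrullDim_eq_zero_of_field, zero_add, Nat.card_fin] at hr
    exact_mod_cast hr
  have halg : Algebra.IsAlgebraic (Algebra.adjoin K (Set.range a)) D := by
    rw [ha]
    exact ⟨fun d => isAlgebraic_algebraMap (⟨d, Algebra.mem_top⟩ : (⊤ : Subalgebra K D))⟩
  obtain ⟨s, hs, hbasis⟩ := exists_isTranscendenceBasis_subset (R := K) (Set.range a)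
  have hsf : Finite s := (Set.finite_range a).subset hs
  have hcard : e ≤ Nat.card s := by
    have h1 := ((MvPolynomial.algebraicIndependent_X (Fin e) K).map' hg).lift_cardinalMk_le_trdeg
    rw [← hbasis.cardinalMk_eq_trdeg] at h1
    have h2 : (e : Cardinal) ≤ (Nat.card s : Cardinal) := by
      rw [Nat.cast_card]
      simpa using h1
    exact_mod_cast h2
  let f : Fin r → s := fun j => (Finite.equivFin s).symm ⟨j, j.2.trans_le (he.trans hcard)⟩
  have hf : Function.Injective f := fun j k h => by
    exact Fin.ext (Fin.mk.inj_iff.1 ((Finite.equivFin s).symm.injective h))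
  choose i hi using fun j => hs (f j).2
  refine ⟨i, ?_⟩
  simp only [hi]
  exact hbasis.1.comp f hf

/-- A chain of primes above the kernel of `f : R → B` bounds the transcendence degree of the image
of `f` from below. -/
theorem exists_algebraicIndependent_of_ltSeries {K R B : Type*} [Field K] [CommRing R] [CommRing B]
    [Algebra K R] [Algebra K B] (f : R →ₐ[K] B) {n : ℕ} {a : Fin n → R}
    (ha : Algebra.adjoin K (Set.range a) = ⊤) (l : LTSeries (PrimeSpectrum R))
    (hl : ∀ b, f b = 0 → b ∈ l.head.asIdeal) :
    ∃ i : Fin l.length → Fin n, AlgebraicIndependent K fun j => f (a (i j)) := by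
  have hdim : (l.length : WithBot ℕ∞) ≤ ringKrullDim (R ⧸ l.head.asIdeal) := by
    rw [ringKrullDim_quotient, Order.le_krullDim_iff]
    exact ⟨⟨l.length, fun k => ⟨l k, l.head_le k⟩, fun k => l.step k⟩, rfl⟩
  have ha' : Algebra.adjoin K (Set.range (Ideal.Quotient.mkₐ K l.head.asIdeal ∘ a)) = ⊤ := by
    rw [Set.range_comp, Algebra.adjoin_image, ha, Algebra.map_top, AlgHom.range_eq_top]
    exact Ideal.Quotient.mkₐ_surjective K _
  obtain ⟨i, hi⟩ := exists_algebraicIndependent_of_le_ringKrullDim ha' hdim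
  exact ⟨i, algebraicIndependent_of_ker_le f (Ideal.Quotient.mkₐ K l.head.asIdeal)
    (fun b hb => Ideal.Quotient.eq_zero_iff_mem.2 (hl b hb)) hi⟩

section OrbitMap

variable {K : Type*} [Field K] {G X : Type*} [AffineVariety K G] [AffineVariety K X]

/-- Evaluation of the first factor of `K[X] ⊗ K[G]` at the point `x`. -/
def evalLeft (K : Type*) [Field K] (G : Type*) {X : Type*} [AffineVariety K G] [AffineVariety K X]
    (x : X) : CoordRing K X ⊗[K] CoordRing K G →ₐ[K] CoordRing K G :=
  Algebra.TensorProduct.lift ((Algebra.ofId K _).comp (evalAt K x)) (AlgHom.id K _)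
    fun _ _ => Commute.all _ _

theorem evalLeft_tmul (x : X) (f : CoordRing K X) (h : CoordRing K G) :
    evalLeft K G x (f ⊗ₜ[K] h) = algebraMap K _ (f.1 x) * h := by
  simp [evalLeft, evalAt, Algebra.ofId_apply]

theorem evalLeft_apply (x : X) (t : CoordRing K X ⊗[K] CoordRing K G) (σ : G) :
    (evalLeft K G x t).1 σ = tensorToFun K X G t (x, σ) := by
  induction t with
  | zero => simp
  | tmul f h => rw [evalLeft_tmul, tensorToFun_tmul]; rfl
  | add s t hs ht => rw [map_add, map_add, Pi.add_apply, ← hs, ← ht]; rfl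

variable [Group G] [MulAction G X] [GVariety K G X]

/-- The homomorphism `K[X] → K[G]` dual to the orbit map `σ ↦ σ x`. -/
def orbitMap (K : Type*) [Field K] (G : Type*) {X : Type*} [Group G] [AffineVariety K G]
    [AffineVariety K X] [MulAction G X] [GVariety K G X] (x : X) :
    CoordRing K X →ₐ[K] CoordRing K G where
  toFun f := ⟨fun σ => f.1 (σ • x), by
    convert (evalLeft K G x (coaction K G f)).2 using 1
    funext σ
    rw [evalLeft_apply, coaction_spec]⟩
  map_one' := rfl
  map_mul' _ _ := rfl
  map_zero' := rfl
  map_add' _ _ := rfl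
  commutes' _ := rfl

theorem orbitMap_apply (x : X) (f : CoordRing K X) (σ : G) :
    (orbitMap K G x f).1 σ = f.1 (σ • x) := rfl

theorem evalLeft_coaction (x : X) (f : CoordRing K X) :
    evalLeft K G x (coaction K G f) = orbitMap K G x f := by
  ext σ
  rw [evalLeft_apply, coaction_spec, orbitMap_apply]

open MvPolynomial in
/-- The orbit of `x` has dimension at least the number of algebraically independent functions on `G`
that come from `X`: a chain of coordinate subspaces of `K^r` through a general point lifts to a
chain of irreducible closed subsets of `G`, whose images in the orbit remain distinct. -/
theorem le_dimSubset_orbit_of_algebraicIndependent [IsAlgClosed K] (x : X) {r : ℕ}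
    {b : Fin r → CoordRing K X} (hb : AlgebraicIndependent K fun j => orbitMap K G x (b j)) :
    (r : WithBot ℕ∞) ≤ dimSubset K (MulAction.orbit G x) := by
  let t : Fin r → CoordRing K G := fun j => orbitMap K G x (b j)
  let _ : Algebra (MvPolynomial (Fin r) K) (CoordRing K G) :=
    (aeval t : _ →ₐ[K] CoordRing K G).toRingHom.toAlgebra
  have hmap : ∀ p, algebraMap (MvPolynomial (Fin r) K) (CoordRing K G) p = aeval t p :=
    fun _ => rfl
  have : IsScalarTower K (MvPolynomial (Fin r) K) (CoordRing K G) :=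
    IsScalarTower.of_algebraMap_eq fun r => by
      rw [hmap, algebraMap_eq, aeval_C]
  have : Algebra.FiniteType (MvPolynomial (Fin r) K) (CoordRing K G) :=
    Algebra.FiniteType.of_restrictScalars_finiteType K _ _
  obtain ⟨e, g, c, hc, hg_inj, hg⟩ := exists_mvPolynomial_isIntegralAway
    (MvPolynomial (Fin r) K) (CoordRing K G) hb
  have hgC : ∀ p, g (C p) = aeval t p := fun p => g.commutes p
  have : Infinite K := IsAlgClosed.instInfinite
  obtain ⟨β, hβ⟩ : ∃ β, eval β c ≠ 0 := by
    by_contra! h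
    exact hc (MvPolynomial.funext fun β => by rw [h, map_zero])
  -- `φ k` specializes the first `k` variables to the coordinates of `β`.
  let φ : ℕ → MvPolynomial (Fin r) K →ₐ[K] MvPolynomial (Fin r) K := fun k =>
    aeval fun j => if j.val < k then C (β j) else MvPolynomial.X j
  have hφ_succ : ∀ k, (φ (k + 1)).comp (φ k) = φ (k + 1) := fun k => by
    ext1 j
    by_cases hj : j.val < k
    · simp [φ, hj, hj.le, ← algebraMap_eq]
    · simp [φ, hj]
  have hφ_eval : ∀ k p, eval β (φ k p) = eval β p := fun k p => by
    have : ((aeval β : MvPolynomial (Fin r) K →ₐ[K] K).comp (φ k)) = aeval β := by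
      ext1 j
      by_cases hj : j.val < k <;> simp [φ, hj]
    exact DFunLike.congr_fun this p
  let P : ℕ → Ideal (MvPolynomial (Fin e) (MvPolynomial (Fin r) K)) := fun k =>
    RingHom.ker (map (φ k : MvPolynomial (Fin r) K →+* MvPolynomial (Fin r) K))
  have hPC : ∀ k p, C p ∈ P k ↔ φ k p = 0 := fun k p => by
    rw [RingHom.mem_ker, map_C, map_eq_zero_iff _ (C_injective _ _)]
    rfl
  obtain ⟨Q, hQ, hQmono, hQP⟩ := hg.exists_chain P (fun k => RingHom.ker_isPrime _)
    (monotone_nat_of_le_succ fun k p hp => by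
      have : map (φ (k + 1) : MvPolynomial (Fin r) K →+* MvPolynomial (Fin r) K) p =
          map (φ (k + 1) : MvPolynomial (Fin r) K →+* MvPolynomial (Fin r) K)
            (map (φ k : MvPolynomial (Fin r) K →+* MvPolynomial (Fin r) K) p) := by
        rw [map_map]
        congr 2
        exact congrArg AlgHom.toRingHom (hφ_succ k).symm
      rw [RingHom.mem_ker, this, (RingHom.mem_ker).1 hp, map_zero])
    (fun k h => hβ (by rw [← hφ_eval k, (hPC k c).1 h, map_zero]))
    (((RingHom.injective_iff_ker_eq_bot
      (g : MvPolynomial (Fin e) (MvPolynomial (Fin r) K) →+* CoordRing K G)).1 hg_inj).trans_le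
        bot_le)
  have hQt : ∀ k p, aeval t p ∈ Q k ↔ φ k p = 0 := fun k p => by
    rw [← hPC, ← hQP, Ideal.mem_comap, ← hgC]
    rfl
  let q : ℕ → Ideal (CoordRing K X) := fun k => (Q k).comap (orbitMap K G x)
  have hq : ∀ k, (q k).IsPrime := fun k => Ideal.comap_isPrime _ _
  have hq_lt : ∀ k < r, q k < q (k + 1) := fun k hk => by
    refine lt_of_le_of_ne (Ideal.comap_mono (hQmono k.le_succ)) fun h => ?_
    let p : MvPolynomial (Fin r) K := MvPolynomial.X ⟨k, hk⟩ - C (β ⟨k, hk⟩)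
    have hp : aeval t p = orbitMap K G x (b ⟨k, hk⟩ - algebraMap K _ (β ⟨k, hk⟩)) := by
      simp [p, t]
    have h1 : aeval t p ∈ Q (k + 1) := by
      rw [hQt]
      simp [p, φ, ← algebraMap_eq]
    rw [hp, ← Ideal.mem_comap] at h1
    change _ ∈ q (k + 1) at h1
    rw [← h, Ideal.mem_comap, ← hp, hQt] at h1
    have h2 : eval (β + 1) (φ k p) = 0 := by rw [h1, map_zero]
    simp [p, φ] at h2
  have hqv : ∀ k, vanishingIdealOn (Subtype.val : MulAction.orbit G x → X)
      (zeroLocusOn Subtype.val (q k)) = q k := by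
    refine fun k => le_antisymm (fun f hf => ?_) fun f hf y hy => hy f hf
    by_contra hfq
    obtain ⟨σ, hσ, hfσ⟩ := exists_point_ne_zero (hQ k).isRadical (f := orbitMap K G x f) hfq
    exact hfσ (hf ⟨σ • x, MulAction.mem_orbit x σ⟩ fun h hh => hσ _ hh)
  rw [dimSubset, topologicalKrullDim_induced_zariski, Order.le_krullDim_iff]
  exact ⟨⟨r, fun k => ⟨⟨q k, hq k⟩, hqv k⟩, fun k => hq_lt k k.2⟩, rfl⟩

/-- A chain of irreducible closed subsets of the orbit of `x` gives a chain of primes of `K[X]`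
above the kernel of the map to `K[G]`, so the transcendence degree of the image is large. -/
theorem exists_algebraicIndependent_of_le_dimSubset_orbit (x : X) {n : ℕ}
    {a : Fin n → CoordRing K X}
    (ha : Algebra.adjoin K (Set.range a) = ⊤) {r : ℕ}
    (hr : (r : WithBot ℕ∞) ≤ dimSubset K (MulAction.orbit G x)) :
    ∃ i : Fin r → Fin n, AlgebraicIndependent K fun j => orbitMap K G x (a (i j)) := by
  rw [dimSubset, topologicalKrullDim_induced_zariski, Order.le_krullDim_iff] at hr
  obtain ⟨l, rfl⟩ := hr
  refine exists_algebraicIndependent_of_ltSeries (orbitMap K G x) ha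
    (l.map Subtype.val (Subtype.strictMono_coe _)) fun f hf => ?_
  change f ∈ l.head.1.asIdeal
  rw [← l.head.2]
  rintro ⟨_, σ, rfl⟩ -
  rw [← orbitMap_apply, hf]
  rfl

end OrbitMap

/-! ### From special points to the generic point -/

/-- A `K`-point of `R` extends to a place of any field `L` that contains `R`. -/
theorem exists_valuationSubring_of_algHom {K R L : Type*} [Field K] [CommRing R] [Algebra K R]
    [Field L] [Algebra R L] (hRL : Function.Injective (algebraMap R L)) (ε : R →ₐ[K] K) :
    ∃ (O : ValuationSubring L) (φ : R →+* O), (∀ r, (φ r : L) = algebraMap R L r) ∧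
      ∀ r, ε r = 0 → φ r ∈ IsLocalRing.maximalIdeal O := by
  let P : Ideal R := RingHom.ker ε
  have hP : P.IsPrime := RingHom.ker_isPrime ε
  have hunit : ∀ y : P.primeCompl, IsUnit (algebraMap R L y) := fun y => by
    refine IsUnit.mk0 _ ((map_ne_zero_iff _ hRL).2 fun h => y.2 ?_)
    rw [h]
    exact P.zero_mem
  obtain ⟨O, hO, hloc⟩ := IsLocalRing.exists_factor_valuationRing
    (IsLocalization.lift hunit : Localization.AtPrime P →+* L)
  refine ⟨O, (RingHom.codRestrict _ O.toSubring hO).comp (algebraMap R (Localization.AtPrime P)),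
    fun r => IsLocalization.lift_eq hunit r, fun r hr => ?_⟩
  rw [IsLocalRing.mem_maximalIdeal, mem_nonunits_iff]
  intro hu
  have h1 := hloc.map_nonunit _ hu
  exact (IsLocalization.AtPrime.isUnit_to_map_iff _ P r).1 h1 hr

/-- Algebraic independence is inherited from a special point to the generic point. Given a relation
over `L`, divide it by a coefficient of largest value with respect to a place of `L` centred at the
special point, and reduce it modulo the maximal ideal of the place. -/
theorem algebraicIndependent_of_specialization {K R L B : Type*} [Field K] [CommRing R]
    [Algebra K R] [Field L] [Algebra K L] [Algebra R L] [IsScalarTower K R L] [CommRing B]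
    [Algebra K B] (hRL : Function.Injective (algebraMap R L)) (ε : R →ₐ[K] K) {ι : Type*}
    {g : ι → R ⊗[K] B}
    (hg : AlgebraicIndependent K fun j => Algebra.TensorProduct.lift ((Algebra.ofId K B).comp ε)
      (AlgHom.id K B) (fun _ _ => Commute.all _ _) (g j)) :
    AlgebraicIndependent L fun j => Algebra.TensorProduct.map (IsScalarTower.toAlgHom K R L)
      (AlgHom.id K B) (g j) := by
  classical
  obtain ⟨O, φ, hφ, hφm⟩ := exists_valuationSubring_of_algHom hRL ε
  let _ : Algebra K O := (φ.comp (algebraMap K R)).toAlgebra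
  have : IsScalarTower K O L := IsScalarTower.of_algebraMap_eq fun c => by
    rw [IsScalarTower.algebraMap_apply K R L]
    exact (hφ _).symm
  let κ := IsLocalRing.ResidueField O
  let φ' : R →ₐ[K] O := { φ with commutes' := fun _ => rfl }
  have hφ' : ∀ r, ((φ' r : O) : L) = algebraMap R L r := hφ
  have hres : ∀ r, IsLocalRing.residue O (φ r) = algebraMap K κ (ε r) := fun r => by
    have h1 : φ (r - algebraMap K R (ε r)) ∈ IsLocalRing.maximalIdeal O := hφm _ (by simp)
    rw [← IsLocalRing.residue_eq_zero_iff, map_sub, map_sub, sub_eq_zero] at h1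
    exact h1
  let gO : ι → O ⊗[K] B := fun j => Algebra.TensorProduct.map φ' (AlgHom.id K B) (g j)
  let toL : O ⊗[K] B →ₐ[K] L ⊗[K] B :=
    Algebra.TensorProduct.map (IsScalarTower.toAlgHom K O L) (AlgHom.id K B)
  let toκ : O ⊗[K] B →ₐ[K] κ ⊗[K] B :=
    Algebra.TensorProduct.map (IsScalarTower.toAlgHom K O κ) (AlgHom.id K B)
  have htoL : Function.Injective toL :=
    Module.Flat.rTensor_preserves_injective_linearMap (M := B)
      (IsScalarTower.toAlgHom K O L).toLinearMap Subtype.val_injective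
  have hgL : ∀ z, toL (Algebra.TensorProduct.map φ' (AlgHom.id K B) z) =
      Algebra.TensorProduct.map (IsScalarTower.toAlgHom K R L) (AlgHom.id K B) z := fun z => by
    have : toL.comp (Algebra.TensorProduct.map φ' (AlgHom.id K B)) =
        Algebra.TensorProduct.map (IsScalarTower.toAlgHom K R L) (AlgHom.id K B) := by
      ext r
      · simpa [toL] using congrArg (· ⊗ₜ[K] (1 : B)) (hφ' r)
      · simp [toL]
    exact DFunLike.congr_fun this z
  have hgκ : ∀ z, toκ (Algebra.TensorProduct.map φ' (AlgHom.id K B) z) =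
      1 ⊗ₜ[K] Algebra.TensorProduct.lift ((Algebra.ofId K B).comp ε)
        (AlgHom.id K B) (fun _ _ => Commute.all _ _) z := fun z => by
    have : toκ.comp (Algebra.TensorProduct.map φ' (AlgHom.id K B)) =
        (Algebra.TensorProduct.includeRight : B →ₐ[K] κ ⊗[K] B).comp
          (Algebra.TensorProduct.lift ((Algebra.ofId K B).comp ε)
            (AlgHom.id K B) (fun _ _ => Commute.all _ _)) := by
      ext r
      · have h1 : toκ (φ' r ⊗ₜ[K] 1) = algebraMap K κ (ε r) ⊗ₜ[K] (1 : B) :=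
          congrArg (· ⊗ₜ[K] (1 : B)) (hres r)
        simpa [Algebra.ofId_apply, Algebra.algebraMap_eq_smul_one, TensorProduct.smul_tmul] using h1
      · simp [toκ]
    exact DFunLike.congr_fun this z
  have hκ := algebraicIndependent_tmul κ hg
  refine (injective_iff_map_eq_zero _).2 fun F hF => ?_
  by_contra hF0
  obtain ⟨m, hm, hmax⟩ := Finset.exists_max_image F.support
    (fun m => O.valuation (F.coeff m)) (MvPolynomial.support_nonempty.2 hF0)
  have hc : F.coeff m ≠ 0 := MvPolynomial.mem_support_iff.1 hm
  obtain ⟨F₀, hF₀⟩ : MvPolynomial.C (F.coeff m)⁻¹ * F ∈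
      Set.range (MvPolynomial.map (algebraMap O L)) := by
    rw [MvPolynomial.mem_range_map_iff_coeffs_subset]
    intro y hy
    obtain ⟨k, hk, rfl⟩ := MvPolynomial.mem_coeffs_iff.1 hy
    have hk' : k ∈ F.support := by
      rw [MvPolynomial.mem_support_iff, MvPolynomial.coeff_C_mul] at hk
      exact MvPolynomial.mem_support_iff.2 (right_ne_zero_of_mul hk)
    rw [MvPolynomial.coeff_C_mul]
    have hmem : (F.coeff m)⁻¹ * F.coeff k ∈ O := by
      rw [← O.valuation_le_one_iff, map_mul, map_inv₀,
        inv_mul_le_one₀ (zero_lt_iff.2 ((Valuation.ne_zero_iff _).2 hc))]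
      exact hmax k hk'
    exact ⟨⟨_, hmem⟩, rfl⟩
  have haevalL : ∀ p : MvPolynomial ι O, toL (MvPolynomial.aeval gO p) =
      MvPolynomial.aeval (fun j => toL (gO j)) (MvPolynomial.map (algebraMap O L) p) := fun p => by
    induction p using MvPolynomial.induction_on with
    | C r => simp [toL]
    | add p q hp hq => simp only [map_add, hp, hq]
    | mul_X p i hp => simp only [map_mul, hp, MvPolynomial.map_X, MvPolynomial.aeval_X]
  have haevalκ : ∀ p : MvPolynomial ι O, toκ (MvPolynomial.aeval gO p) =
      MvPolynomial.aeval (fun j => toκ (gO j)) (MvPolynomial.map (algebraMap O κ) p) := fun p => by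
    induction p using MvPolynomial.induction_on with
    | C r => simp [toκ]
    | add p q hp hq => simp only [map_add, hp, hq]
    | mul_X p i hp => simp only [map_mul, hp, MvPolynomial.map_X, MvPolynomial.aeval_X]
  have h0 : MvPolynomial.aeval gO F₀ = 0 := by
    refine htoL ?_
    rw [haevalL, hF₀, map_zero, map_mul]
    simp only [gO, hgL]
    rw [hF, mul_zero]
  have h1 := haevalκ F₀
  rw [h0, map_zero] at h1
  simp only [gO, hgκ] at h1
  have h2 : MvPolynomial.map (algebraMap O κ) F₀ = 0 := (injective_iff_map_eq_zero _).1 hκ _ h1.symm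
  -- The coefficient of `F₀` at `m` is `1`, which does not reduce to `0`.
  have h3 : F₀.coeff m = 1 := Subtype.val_injective <| by
    have := congrArg (MvPolynomial.coeff m) hF₀
    rw [MvPolynomial.coeff_map, MvPolynomial.coeff_C_mul, inv_mul_cancel₀ hc] at this
    exact this
  have h4 := congrArg (MvPolynomial.coeff m) h2
  rw [MvPolynomial.coeff_map, h3, map_one, MvPolynomial.coeff_zero] at h4
  exact one_ne_zero h4

/-! ### From the generic point to special points -/

open MvPolynomial in
/-- Algebraic independence at the generic point is inherited by the special points outside some
hypersurface. The map `Spec (R ⊗ B) → 𝔸^r_R` given by `g` is dominant, so its image contains a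
nonempty open set, which contains the generic point of the fibre of `𝔸^r_R` over a general `K`-point
of `R`. -/
theorem exists_algebraicIndependent_specialization {K R L B : Type*} [Field K] [CommRing R]
    [Algebra K R] [Field L] [Algebra K L] [Algebra R L] [IsScalarTower K R L] [CommRing B]
    [Algebra K B] [Algebra.FiniteType K B] (hRL : Function.Injective (algebraMap R L)) {r : ℕ}
    {g : Fin r → R ⊗[K] B}
    (hg : AlgebraicIndependent L fun j => Algebra.TensorProduct.map (IsScalarTower.toAlgHom K R L)
      (AlgHom.id K B) (g j)) :
    ∃ f : R, f ≠ 0 ∧ ∀ ε : R →ₐ[K] K, ε f ≠ 0 →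
      AlgebraicIndependent K fun j => Algebra.TensorProduct.lift ((Algebra.ofId K B).comp ε)
        (AlgHom.id K B) (fun _ _ => Commute.all _ _) (g j) := by
  have hR : IsDomain R := hRL.isDomain (algebraMap R L)
  let _ : Algebra (MvPolynomial (Fin r) R) (R ⊗[K] B) :=
    (aeval g : _ →ₐ[R] R ⊗[K] B).toRingHom.toAlgebra
  have hmap : ∀ p, algebraMap (MvPolynomial (Fin r) R) (R ⊗[K] B) p = aeval g p := fun _ => rfl
  have : IsScalarTower R (MvPolynomial (Fin r) R) (R ⊗[K] B) :=
    IsScalarTower.of_algebraMap_eq fun s => by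
      rw [hmap, algebraMap_eq, aeval_C]
  have : Algebra.FiniteType (MvPolynomial (Fin r) R) (R ⊗[K] B) :=
    Algebra.FiniteType.of_restrictScalars_finiteType R _ _
  let toL : R ⊗[K] B →ₐ[K] L ⊗[K] B :=
    Algebra.TensorProduct.map (IsScalarTower.toAlgHom K R L) (AlgHom.id K B)
  have htoL : ∀ p : MvPolynomial (Fin r) R, toL (aeval g p) =
      aeval (fun j => toL (g j)) (map (algebraMap R L) p) := fun p => by
    induction p using MvPolynomial.induction_on with
    | C s => simp [toL]
    | add p q hp hq => simp only [map_add, hp, hq]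
    | mul_X p i hp => simp only [map_mul, hp, map_X, aeval_X]
  have hinj : Function.Injective (algebraMap (MvPolynomial (Fin r) R) (R ⊗[K] B)) := by
    refine (injective_iff_map_eq_zero _).2 fun p hp => ?_
    rw [hmap] at hp
    have h1 := htoL p
    rw [hp, map_zero] at h1
    exact map_injective _ hRL (((injective_iff_map_eq_zero _).1 hg _ h1.symm).trans
      (map_zero _).symm)
  obtain ⟨e, h, c, hc, hh_inj, hh⟩ := exists_mvPolynomial_isIntegralAway
    (MvPolynomial (Fin r) R) (R ⊗[K] B) hinj
  have hhC : ∀ p, h (C p) = aeval g p := fun p => h.commutes p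
  obtain ⟨m, hm⟩ := ne_zero_iff.1 hc
  refine ⟨c.coeff m, hm, fun ε hε => ?_⟩
  let P : Ideal (MvPolynomial (Fin e) (MvPolynomial (Fin r) R)) :=
    RingHom.ker (map (map (ε : R →+* K)) :
      MvPolynomial (Fin e) (MvPolynomial (Fin r) R) →+*
        MvPolynomial (Fin e) (MvPolynomial (Fin r) K))
  have hPC : ∀ p, C p ∈ P ↔ map (ε : R →+* K) p = 0 := fun p => by
    rw [RingHom.mem_ker, map_C, map_eq_zero_iff _ (C_injective _ _)]
  have hP : P.IsPrime := RingHom.ker_isPrime _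
  have hcP : C c ∉ P := fun h => hε <| by
    have := congrArg (coeff m) ((hPC c).1 h)
    rwa [coeff_map, coeff_zero] at this
  obtain ⟨Q, -, hQ, hQP⟩ := hh.exists_ideal_over_prime P hcP ⊥
    (((RingHom.injective_iff_ker_eq_bot (h : MvPolynomial (Fin e) (MvPolynomial (Fin r) R) →+*
      R ⊗[K] B)).1 hh_inj).trans_le bot_le)
  have hQg : ∀ p, aeval g p ∈ Q ↔ map (ε : R →+* K) p = 0 := fun p => by
    rw [← hPC, ← hQP, Ideal.mem_comap, ← hhC]
    rfl
  let τ : R ⊗[K] B →ₐ[K] B := Algebra.TensorProduct.lift ((Algebra.ofId K B).comp ε)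
    (AlgHom.id K B) (fun _ _ => Commute.all _ _)
  -- `Q` contains the kernel of the specialization `τ`.
  have hτQ : ∀ z, z - 1 ⊗ₜ[K] τ z ∈ Q := fun z => by
    induction z with
    | zero => simp
    | tmul s b =>
      have h1 : aeval g (C (s - algebraMap K R (ε s)) : MvPolynomial (Fin r) R) ∈ Q := by
        rw [hQg, map_C]
        simp
      have h2 : s ⊗ₜ[K] b - 1 ⊗ₜ[K] τ (s ⊗ₜ[K] b) =
          aeval g (C (s - algebraMap K R (ε s)) : MvPolynomial (Fin r) R) * 1 ⊗ₜ[K] b := by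
        simp [τ, Algebra.ofId_apply, sub_mul, Algebra.algebraMap_eq_smul_one,
          TensorProduct.smul_tmul']
      rw [h2]
      exact Q.mul_mem_right _ h1
    | add y z hy hz =>
      rw [map_add, TensorProduct.tmul_add, add_sub_add_comm]
      exact Q.add_mem hy hz
  refine (injective_iff_map_eq_zero _).2 fun F hF => ?_
  have hτ : ∀ p : MvPolynomial (Fin r) K, τ (aeval g (map (algebraMap K R) p)) =
      aeval (fun j => τ (g j)) p := fun p => by
    rw [aeval_map_algebraMap]
    exact comp_aeval_apply g τ p
  have h1 := hτQ (aeval g (map (algebraMap K R) F))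
  rw [hτ, hF, TensorProduct.tmul_zero, sub_zero, hQg, map_map] at h1
  have h2 : (ε : R →+* K).comp (algebraMap K R) = RingHom.id K := RingHom.ext fun s => ε.commutes s
  rwa [h2, map_id] at h1

/-- If `Q` is a prime of `B` through a `K`-point at which `h ∈ L ⊗ B` does not vanish, then `h` lies
outside the prime `L ⊗ Q` of `L ⊗ B`. -/
theorem exists_prime_tensor {K L B : Type*} [Field K] [IsAlgClosed K] [Field L] [Algebra K L]
    [CommRing B] [Algebra K B] [Algebra.FiniteType K B] (Q : Ideal B) [Q.IsPrime] {ι : Type*}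
    {s : ι → B} (hs : AlgebraicIndependent K fun i => Ideal.Quotient.mk Q (s i))
    {φ : B →ₐ[K] K} (hφ : Q ≤ RingHom.ker φ) {h : L ⊗[K] B} (hh : evalRight L φ h ≠ 0) :
    ∃ P : Ideal (L ⊗[K] B), P.IsPrime ∧ h ∉ P ∧
      ∃ s : ι → L ⊗[K] B, AlgebraicIndependent L fun i => Ideal.Quotient.mk P (s i) := by
  have : IsDomain (L ⊗[K] (B ⧸ Q)) := isDomain_tensor L
  let π : L ⊗[K] B →ₐ[L] L ⊗[K] (B ⧸ Q) :=
    Algebra.TensorProduct.map (AlgHom.id L L) (Ideal.Quotient.mkₐ K Q)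
  have hfac : (evalRight L (Ideal.Quotient.liftₐ Q φ hφ)).comp π = evalRight L φ := by
    ext b
    simp [evalRight, π]
    rfl
  refine ⟨RingHom.ker π, RingHom.ker_isPrime π, fun h0 => hh ?_, fun i => 1 ⊗ₜ s i, ?_⟩
  · rw [← hfac, AlgHom.comp_apply, (RingHom.mem_ker).1 h0, map_zero]
  · refine algebraicIndependent_of_ker_le (Ideal.Quotient.mkₐ L (RingHom.ker π)) π
      (fun x hx => Ideal.Quotient.eq_zero_iff_mem.1 hx) ?_
    simpa [π] using algebraicIndependent_tmul L hs

/-- If the automorphisms of `Spec B` act transitively on its `K`-points, then every nonempty open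
subset of `Spec (L ⊗ B)` meets an irreducible component of maximal dimension. -/
theorem exists_prime_tensor_of_transitive {K L B : Type*} [Field K] [IsAlgClosed K] [Field L]
    [Algebra K L] [CommRing B] [IsReduced B] [Algebra K B] [Algebra.FiniteType K B]
    (htrans : ∀ φ ψ : B →ₐ[K] K, ∃ T T' : B →ₐ[K] B, (∀ b, T (T' b) = b) ∧ ψ.comp T = φ)
    {ι : Type*} {s : ι → B} (hs : AlgebraicIndependent K s) {h : L ⊗[K] B} (hh : h ≠ 0) :
    ∃ P : Ideal (L ⊗[K] B), P.IsPrime ∧ h ∉ P ∧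
      ∃ s : ι → L ⊗[K] B, AlgebraicIndependent L fun i => Ideal.Quotient.mk P (s i) := by
  obtain ⟨u, hu, hu'⟩ := exists_forall_evalRight_ne_zero hh
  obtain ⟨φ, -, hφ⟩ := exists_algHom_ne_zero (K := K) (I := (⊥ : Ideal B))
    (Ideal.isRadical_bot_iff.2 inferInstance) (u := u) hu
  obtain ⟨Q, hQ, hsQ⟩ := exists_prime_algebraicIndependent hs
  obtain ⟨ψ, hψ, -⟩ := exists_algHom_ne_zero (K := K) hQ.isRadical
    ((Ideal.ne_top_iff_one _).1 hQ.ne_top)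
  obtain ⟨T, T', hT, rfl⟩ := htrans φ ψ
  refine exists_prime_tensor (Q.comap T) (s := fun i => T' (s i)) (φ := ψ.comp T) ?_
    (fun f hf => hψ hf) (hu' _ hφ)
  refine algebraicIndependent_of_ker_le (Ideal.Quotient.mkₐ K (Q.comap T))
    ((Ideal.Quotient.mkₐ K Q).comp T)
    (fun x hx => Ideal.Quotient.eq_zero_iff_mem.2 <| Ideal.mem_comap.1 <|
      Ideal.Quotient.eq_zero_iff_mem.1 hx) ?_
  simpa [hT] using hsQ

theorem exists_isIntegral_tensor {K L B : Type*} [Field K] [Field L] [Algebra K L] [CommRing B]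
    [Algebra K B] {N : ℕ} (g : MvPolynomial (Fin N) K →ₐ[K] B)
    (hg : (g : MvPolynomial (Fin N) K →+* B).IsIntegral) :
    ∃ g' : MvPolynomial (Fin N) L →ₐ[L] L ⊗[K] B,
      (g' : MvPolynomial (Fin N) L →+* L ⊗[K] B).IsIntegral := by
  let γ : L ⊗[K] MvPolynomial (Fin N) K →ₐ[L] L ⊗[K] B :=
    Algebra.TensorProduct.map (AlgHom.id L L) g
  have hγ : γ.toRingHom.IsIntegral := fun z => by
    induction z with
    | zero => exact RingHom.isIntegralElem_zero _
    | tmul l b =>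
      have h1 : γ.toRingHom.IsIntegralElem (l ⊗ₜ 1) := by
        have : γ.toRingHom (l ⊗ₜ 1) = l ⊗ₜ 1 := by simp [γ]
        rw [← this]
        exact RingHom.isIntegralElem_map _
      have h2 : γ.toRingHom.IsIntegralElem (1 ⊗ₜ b) := by
        obtain ⟨p, hp, hpb⟩ := hg b
        refine ⟨p.map (Algebra.TensorProduct.includeRight :
          MvPolynomial (Fin N) K →ₐ[K] L ⊗[K] MvPolynomial (Fin N) K).toRingHom, hp.map _, ?_⟩
        have h3 : γ.toRingHom.comp (Algebra.TensorProduct.includeRight :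
            MvPolynomial (Fin N) K →ₐ[K] L ⊗[K] MvPolynomial (Fin N) K).toRingHom =
            (Algebra.TensorProduct.includeRight : B →ₐ[K] L ⊗[K] B).toRingHom.comp
              (g : MvPolynomial (Fin N) K →+* B) := by
          refine RingHom.ext fun x => ?_
          simp [γ]
        have h4 := congrArg (Algebra.TensorProduct.includeRight : B →ₐ[K] L ⊗[K] B).toRingHom hpb
        rw [Polynomial.hom_eval₂, map_zero] at h4
        rw [Polynomial.eval₂_map, h3]
        exact h4
      have h5 : l ⊗ₜ[K] b = (l ⊗ₜ 1) * (1 ⊗ₜ b) := by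
        rw [Algebra.TensorProduct.tmul_mul_tmul, mul_one, one_mul]
      rw [h5]
      exact RingHom.IsIntegralElem.mul _ h1 h2
    | add y z hy hz => exact RingHom.IsIntegralElem.add _ hy hz
  exact ⟨γ.comp (MvPolynomial.algebraTensorAlgEquiv (σ := Fin N) K L).symm.toAlgHom,
    RingHom.IsIntegral.trans _ _ (RingHom.isIntegral_of_surjective _
      (MvPolynomial.algebraTensorAlgEquiv (σ := Fin N) K L).symm.surjective) hγ⟩

/-! ### Linear algebraic groups: the general fibre -/

section Group

variable {K : Type*} [Field K] {G : Type*} [Group G] [AffineVariety K G] [LinearAlgebraicGroup K G]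

/-- The action of a linear algebraic group on itself by left multiplication. -/
instance gvariety_self (K : Type*) [Field K] (G : Type*) [Group G] [AffineVariety K G]
    [LinearAlgebraicGroup K G] : GVariety K G G :=
  ⟨LinearAlgebraicGroup.isMorphism_mul⟩

instance isReduced_coordRing (K : Type*) [Field K] (X : Type*) [AffineVariety K X] :
    IsReduced (CoordRing K X) :=
  isReduced_of_injective (AffineVariety.regular (K := K) (X := X)).val Subtype.val_injective

/-- Right translations act transitively on the points of `G`. -/
theorem exists_translation (φ ψ : CoordRing K G →ₐ[K] K) :
    ∃ T T' : CoordRing K G →ₐ[K] CoordRing K G, (∀ f, T (T' f) = f) ∧ ψ.comp T = φ := by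
  obtain ⟨τ, hτ, -⟩ := AffineVariety.existsUnique_point φ
  obtain ⟨ρ, hρ, -⟩ := AffineVariety.existsUnique_point ψ
  refine ⟨orbitMap K G (ρ⁻¹ * τ), orbitMap K G (τ⁻¹ * ρ), fun f => ?_, ?_⟩
  · ext σ
    simp [orbitMap_apply, mul_assoc]
  · ext f
    rw [AlgHom.comp_apply, hτ, hρ, orbitMap_apply, smul_eq_mul, mul_inv_cancel_left]

end Group

section GenericFibre

variable {K : Type*} [Field K] [IsAlgClosed K] {G : Type*} [Group G] [AffineVariety K G]
  [LinearAlgebraicGroup K G]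

theorem exists_mvPolynomial_isIntegral_coordRing {K : Type*} [Field K] [IsAlgClosed K] {G : Type*}
    [Group G] [AffineVariety K G] :
    ∃ (N : ℕ) (g : MvPolynomial (Fin N) K →ₐ[K] CoordRing K G), Function.Injective g ∧
      (g : MvPolynomial (Fin N) K →+* CoordRing K G).IsIntegral ∧ dimVariety K G = N := by
  have : Nontrivial (CoordRing K G) :=
    ⟨0, 1, fun h => zero_ne_one (congrFun (congrArg Subtype.val h) (1 : G))⟩
  obtain ⟨N, g, hg, hgint⟩ := exists_integral_inj_algHom_of_fg K (CoordRing K G)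
  refine ⟨N, g, hg, hgint, ?_⟩
  rw [dimVariety_eq_ringKrullDim, ringKrullDim_eq_of_isIntegral hgint hg,
    MvPolynomial.ringKrullDim_of_isNoetherianRing, ringKrullDim_eq_zero_of_field, zero_add,
    Nat.card_fin]

/-- The dimension of the general fibres of `d` algebraically independent elements `t` of
`L ⊗ K[G]`. -/
theorem exists_ringKrullDim_fibre_coordRing {L : Type*} [Field L] [Algebra K L] {d : ℕ}
    {t : Fin d → L ⊗[K] CoordRing K G} (ht : AlgebraicIndependent L t) :
    ∃ h : MvPolynomial (Fin d) L, h ≠ 0 ∧ ∀ β : Fin d → L, MvPolynomial.eval β h ≠ 0 →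
      ringKrullDim ((L ⊗[K] CoordRing K G) ⧸
          Ideal.span (Set.range fun i => t i - algebraMap L _ (β i))) +
        (d : WithBot ℕ∞) = dimVariety K G := by
  obtain ⟨N, g, hg, hgint, hN⟩ := exists_mvPolynomial_isIntegral_coordRing (K := K) (G := G)
  obtain ⟨g', hg'⟩ := exists_isIntegral_tensor (L := L) g hgint
  have hs : AlgebraicIndependent K (g ∘ MvPolynomial.X) :=
    (MvPolynomial.algebraicIndependent_X _ K).map' hg
  rw [hN]
  exact exists_ringKrullDim_fibre ht g' hg' fun h hh =>
    exists_prime_tensor_of_transitive exists_translation hs hh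

end GenericFibre

/-! ### Open subsets of affine space and the graph homomorphism -/

section AffineSpace

variable {K : Type*} [Field K] {d : ℕ}

/-- A polynomial as a regular function on affine space. -/
def polyFun (K : Type*) [Field K] (d : ℕ) : MvPolynomial (Fin d) K →ₐ[K] CoordRing K (Fin d → K) :=
  MvPolynomial.aeval fun j => ⟨fun x => x j, Algebra.subset_adjoin ⟨j, rfl⟩⟩

theorem polyFun_apply (p : MvPolynomial (Fin d) K) (β : Fin d → K) :
    (polyFun K d p).1 β = MvPolynomial.eval β p := by
  have h : (evalAt K β).comp (polyFun K d) = MvPolynomial.aeval β := by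
    ext j
    simp [polyFun, evalAt]
  exact DFunLike.congr_fun h p

theorem polyFun_surjective : Function.Surjective (polyFun K d) := by
  rintro ⟨f, hf⟩
  induction hf using Algebra.adjoin_induction with
  | mem f hf =>
    obtain ⟨j, rfl⟩ := hf
    exact ⟨MvPolynomial.X j, by simp [polyFun]⟩
  | algebraMap r => exact ⟨MvPolynomial.C r, (polyFun K d).commutes r⟩
  | add f g hf hg h1 h2 =>
    obtain ⟨p, hp⟩ := h1
    obtain ⟨q, hq⟩ := h2
    exact ⟨p + q, by rw [map_add, hp, hq]; rfl⟩
  | mul f g hf hg h1 h2 =>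
    obtain ⟨p, hp⟩ := h1
    obtain ⟨q, hq⟩ := h2
    exact ⟨p * q, by rw [map_mul, hp, hq]; rfl⟩

theorem isOpen_ne_zero (p : MvPolynomial (Fin d) K) :
    @IsOpen _ (zariski K (Fin d → K)) {β | MvPolynomial.eval β p ≠ 0} := by
  refine ⟨{polyFun K d p}, ?_⟩
  ext β
  simp [zeros, polyFun_apply]

theorem dense_ne_zero [Infinite K] {p : MvPolynomial (Fin d) K} (hp : p ≠ 0) :
    @Dense _ (zariski K (Fin d → K)) {β | MvPolynomial.eval β p ≠ 0} := by
  let _ := zariski K (Fin d → K)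
  rw [dense_iff_inter_open]
  rintro V ⟨S, hS⟩ ⟨β₀, hβ₀⟩
  have hmem : ∀ β, β ∈ V ↔ ∃ f ∈ S, f.1 β ≠ 0 := fun β => by
    rw [← not_iff_not, ← Set.mem_compl_iff, hS]
    simp [zeros]
  obtain ⟨f, hf, hfβ₀⟩ := (hmem β₀).1 hβ₀
  obtain ⟨q, rfl⟩ := polyFun_surjective f
  have hq : q ≠ 0 := by
    rintro rfl
    rw [polyFun_apply, map_zero] at hfβ₀
    exact hfβ₀ rfl
  obtain ⟨β, hβ⟩ : ∃ β, MvPolynomial.eval β (q * p) ≠ 0 := by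
    by_contra! h
    exact mul_ne_zero hq hp (MvPolynomial.funext fun β => by rw [h, map_zero])
  rw [map_mul] at hβ
  exact ⟨β, (hmem β).2 ⟨_, hf, by rw [polyFun_apply]; exact left_ne_zero_of_mul hβ⟩,
    right_ne_zero_of_mul hβ⟩

/-- A nonzero polynomial over an extension `L` of `K` is nonzero on a dense open subset of `K^d`:
apply a `K`-linear functional on `L` to the coefficients. -/
theorem exists_ne_zero_of_eval_ne_zero {L : Type*} [Field L] [Algebra K L]
    {H : MvPolynomial (Fin d) L} (hH : H ≠ 0) :
    ∃ H₀ : MvPolynomial (Fin d) K, H₀ ≠ 0 ∧ ∀ β, MvPolynomial.eval β H₀ ≠ 0 →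
      MvPolynomial.eval (fun j => algebraMap K L (β j)) H ≠ 0 := by
  classical
  obtain ⟨m, hm⟩ := MvPolynomial.ne_zero_iff.1 hH
  obtain ⟨l, hl⟩ : ∃ l : Module.Dual K L, l (H.coeff m) ≠ 0 := by
    by_contra! h
    exact hm ((Module.forall_dual_apply_eq_zero_iff K _).1 h)
  refine ⟨∑ k ∈ H.support, MvPolynomial.monomial k (l (H.coeff k)), fun h0 => hl ?_,
    fun β hβ hH0 => hβ ?_⟩
  · have := congrArg (MvPolynomial.coeff m) h0
    rwa [MvPolynomial.coeff_sum, Finset.sum_eq_single m (fun k _ hk => by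
      rw [MvPolynomial.coeff_monomial, if_neg hk]) (fun hk => by
      rw [MvPolynomial.notMem_support_iff.1 hk]; simp), MvPolynomial.coeff_monomial, if_pos rfl,
      MvPolynomial.coeff_zero] at this
  · rw [MvPolynomial.eval_eq] at hH0
    have := congrArg l hH0
    rw [map_sum, map_zero] at this
    rw [map_sum, ← this]
    refine Finset.sum_congr rfl fun k _ => ?_
    rw [MvPolynomial.eval_monomial, Finsupp.prod_fintype _ _ fun _ => pow_zero _]
    simp only [← map_pow, ← map_prod]
    rw [mul_comm (H.coeff k), ← Algebra.smul_def, map_smul, smul_eq_mul, mul_comm]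
    congr 1
    refine (Finset.prod_subset (Finset.subset_univ _) fun j _ hj => ?_).symm
    rw [Finsupp.notMem_support_iff.1 hj, pow_zero]

end AffineSpace

section Quotients

theorem ringKrullDim_quotient_comap {A B : Type*} [CommRing A] [CommRing B] (f : A →+* B)
    (hf : Function.Surjective f) (I : Ideal B) :
    ringKrullDim (A ⧸ I.comap f) = ringKrullDim (B ⧸ I) := by
  have h : RingHom.ker ((Ideal.Quotient.mk I).comp f) = I.comap f := by
    rw [← RingHom.comap_ker, Ideal.mk_ker]
  rw [← h]
  exact ringKrullDim_eq_of_ringEquiv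
    (RingHom.quotientKerEquivOfSurjective (Ideal.Quotient.mk_surjective.comp hf))

theorem ringKrullDim_quotient_eq_zero {L S : Type*} [Field L] [CommRing S] [Algebra L S] {n : ℕ}
    (g : Fin n → S) {I : Ideal S} (hI : I ≠ ⊤)
    (hg : ∀ k, ∃ q : Polynomial L, q ≠ 0 ∧ Polynomial.aeval (g k) q ∈ I) :
    ringKrullDim (MvPolynomial (Fin n) L ⧸ I.comap (MvPolynomial.aeval g : _ →ₐ[L] S)) = 0 := by
  set E := I.comap (MvPolynomial.aeval g : _ →ₐ[L] S) with hE
  have hX : ∀ k, IsIntegral L (Ideal.Quotient.mkₐ L E (MvPolynomial.X k)) := fun k => by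
    obtain ⟨q, hq, hqI⟩ := hg k
    refine IsAlgebraic.isIntegral ⟨q, hq, ?_⟩
    rw [Polynomial.aeval_algHom_apply, Ideal.Quotient.mkₐ_eq_mk, Ideal.Quotient.eq_zero_iff_mem,
      hE, Ideal.mem_comap]
    rwa [← Polynomial.aeval_algHom_apply, MvPolynomial.aeval_X]
  have hint : (algebraMap L (MvPolynomial (Fin n) L ⧸ E)).IsIntegral := fun z => by
    obtain ⟨p, rfl⟩ := Ideal.Quotient.mkₐ_surjective L E z
    change IsIntegral L _
    induction p using MvPolynomial.induction_on with
    | C r => exact (Ideal.Quotient.mkₐ L E).commutes r ▸ isIntegral_algebraMap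
    | add p q hp hq => rw [map_add]; exact hp.add hq
    | mul_X p k hp => rw [map_mul]; exact hp.mul (hX k)
  have hnt : Nontrivial (MvPolynomial (Fin n) L ⧸ E) := by
    rw [Ideal.Quotient.nontrivial_iff]
    exact Ideal.comap_ne_top _ hI
  refine le_antisymm ?_ ringKrullDim_nonneg_of_nontrivial
  exact (ringKrullDim_le_of_isIntegral hint).trans_eq (ringKrullDim_eq_zero_of_field L)

end Quotients

section GraphHom

variable {K L B : Type*} [Field K] [Field L] [Algebra K L] [CommRing B] [Algebra K B] {n : ℕ}

/-- The homomorphism `L[y₁, …, yₙ] ⊗ B → L ⊗ B` with `yᵢ ↦ gᵢ`. -/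
noncomputable def graphHom (g : Fin n → L ⊗[K] B) : MvPolynomial (Fin n) L ⊗[K] B →ₐ[L] L ⊗[K] B :=
  Algebra.TensorProduct.lift (MvPolynomial.aeval g)
    (Algebra.TensorProduct.includeRight : B →ₐ[K] L ⊗[K] B) fun _ _ => Commute.all _ _

theorem graphHom_includeLeft (g : Fin n → L ⊗[K] B) (p : MvPolynomial (Fin n) L) :
    graphHom g (Algebra.TensorProduct.includeLeft (R := K) (S := K) p) =
      MvPolynomial.aeval g p := by
  simp [graphHom, ← Algebra.TensorProduct.one_def]

theorem graphHom_X (g : Fin n → L ⊗[K] B) (i : Fin n) :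
    graphHom g (MvPolynomial.X i ⊗ₜ 1) = g i := by
  simp [graphHom, ← Algebra.TensorProduct.one_def]

theorem graphHom_map (g : Fin n → L ⊗[K] B) (z : L ⊗[K] B) :
    graphHom g (Algebra.TensorProduct.map (IsScalarTower.toAlgHom K L (MvPolynomial (Fin n) L))
      (AlgHom.id K B) z) = z := by
  induction z with
  | zero => simp
  | tmul l b => simp [graphHom, MvPolynomial.algebraMap_eq]
  | add y z hy hz => rw [map_add, map_add, hy, hz]

theorem graphHom_surjective (g : Fin n → L ⊗[K] B) : Function.Surjective (graphHom g) :=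
  fun z => ⟨_, graphHom_map g z⟩

theorem ker_graphHom (g : Fin n → L ⊗[K] B) :
    RingHom.ker (graphHom g) = Ideal.span (Set.range fun i => MvPolynomial.X i ⊗ₜ[K] (1 : B) -
      Algebra.TensorProduct.map (IsScalarTower.toAlgHom K L (MvPolynomial (Fin n) L))
        (AlgHom.id K B) (g i)) := by
  set D := Ideal.span (Set.range fun i => MvPolynomial.X i ⊗ₜ[K] (1 : B) -
      Algebra.TensorProduct.map (IsScalarTower.toAlgHom K L (MvPolynomial (Fin n) L))
        (AlgHom.id K B) (g i)) with hD
  let incl : L ⊗[K] B →ₐ[L] MvPolynomial (Fin n) L ⊗[K] B :=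
    Algebra.TensorProduct.map (Algebra.ofId L (MvPolynomial (Fin n) L)) (AlgHom.id K B)
  have hincl : ∀ z, Algebra.TensorProduct.map (IsScalarTower.toAlgHom K L (MvPolynomial (Fin n) L))
      (AlgHom.id K B) z = incl z := fun _ => rfl
  refine le_antisymm (fun z hz => ?_) (Ideal.span_le.2 ?_)
  · -- Modulo `D` every element is congruent to its image under `graphHom g`.
    have key : (Ideal.Quotient.mkₐ L D) =
        ((Ideal.Quotient.mkₐ L D).comp incl).comp (graphHom g) := by
      ext i
      · have h : MvPolynomial.X i ⊗ₜ[K] (1 : B) - incl (g i) ∈ D := Ideal.subset_span ⟨i, rfl⟩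
        simpa [graphHom, ← Algebra.TensorProduct.one_def] using Ideal.Quotient.eq.2 h
      · simp [graphHom, incl]
    have h := DFunLike.congr_fun key z
    rw [AlgHom.comp_apply, (RingHom.mem_ker).1 hz, map_zero] at h
    exact Ideal.Quotient.eq_zero_iff_mem.1 h
  · rintro _ ⟨i, rfl⟩
    rw [SetLike.mem_coe, RingHom.mem_ker, map_sub, graphHom_X, graphHom_map, sub_self]

end GraphHom

/-! ### Relations between the generic orbit functions -/

section Relations

open MvPolynomial

/-- If `z` and `t` are algebraically dependent over `L`, then `z` is algebraic over `L` modulo the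
ideal `(t₁ - β₁, …, t_d - β_d)` for general `β`: specialize the variables `t` in a relation. -/
theorem exists_aeval_mem_span_sub {L S : Type*} [Field L] [CommRing S] [Algebra L S] {d : ℕ}
    {t : Fin d → S} {z : S}
    (hz : ¬ AlgebraicIndependent L (Fin.cons z t : Fin (d + 1) → S)) :
    ∃ c : MvPolynomial (Fin d) L, c ≠ 0 ∧ ∀ β : Fin d → L, eval β c ≠ 0 →
      ∃ q : Polynomial L, q ≠ 0 ∧ Polynomial.aeval z q ∈
        Ideal.span (Set.range fun j => t j - algebraMap L S (β j)) := by
  obtain ⟨F, hF, hF0⟩ : ∃ F, aeval (Fin.cons z t : Fin (d + 1) → S) F = 0 ∧ F ≠ 0 := by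
    by_contra! h
    exact hz ((injective_iff_map_eq_zero _).2 h)
  have hF0' : finSuccEquiv L d F ≠ 0 := (map_ne_zero_iff _ (finSuccEquiv L d).injective).2 hF0
  refine ⟨(finSuccEquiv L d F).leadingCoeff, Polynomial.leadingCoeff_ne_zero.2 hF0',
    fun β hβ => ⟨(finSuccEquiv L d F).map (eval β), fun h => hβ ?_, ?_⟩⟩
  · rw [← Polynomial.coeff_natDegree, ← Polynomial.coeff_map, h, Polynomial.coeff_zero]
  · set I := Ideal.span (Set.range fun j => t j - algebraMap L S (β j))
    have key : ∀ F, Ideal.Quotient.mkₐ L I (aeval (Fin.cons z t : Fin (d + 1) → S) F) =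
        Ideal.Quotient.mkₐ L I (Polynomial.aeval z ((finSuccEquiv L d F).map (eval β))) := by
      intro F
      induction F using MvPolynomial.induction_on with
      | C r =>
        rw [← algebraMap_eq, AlgEquiv.commutes, IsScalarTower.algebraMap_apply L
          (MvPolynomial (Fin d) L) (Polynomial (MvPolynomial (Fin d) L))]
        simp [algebraMap_eq]
      | add p q hp hq => simp only [map_add, hp, hq, Polynomial.map_add]
      | mul_X p j hp =>
        rw [map_mul, map_mul, hp, map_mul, Polynomial.map_mul, map_mul, map_mul]
        congr 1
        refine Fin.cases ?_ (fun j => ?_) j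
        · simp [finSuccEquiv_X_zero]
        · have : t j - algebraMap L S (β j) ∈ I := Ideal.subset_span ⟨j, rfl⟩
          simpa [finSuccEquiv_X_succ] using Ideal.Quotient.eq.2 this
    refine Ideal.Quotient.eq_zero_iff_mem.1 ((key F).symm.trans ?_)
    rw [hF, map_zero]

theorem comap_graphHom_span {K L B : Type*} [Field K] [Field L] [Algebra K L] [CommRing B]
    [Algebra K B] {n s : ℕ} (g : Fin n → L ⊗[K] B) (p : Fin s → MvPolynomial (Fin n) L ⊗[K] B) :
    (Ideal.span (Set.range fun j => graphHom g (p j))).comap (graphHom g) =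
      RingHom.ker (graphHom g) ⊔ Ideal.span (Set.range p) := by
  have h : (Ideal.span (Set.range p)).map (graphHom g) =
      Ideal.span (Set.range fun j => graphHom g (p j)) := by
    rw [Ideal.map_span, ← Set.range_comp]
    rfl
  rw [← h, Ideal.comap_map_of_surjective' _ (graphHom_surjective g), sup_comm]

theorem algebraicIndependent_mk_of_eq_ker {L A S : Type*} [CommRing L] [CommRing A] [CommRing S]
    [Algebra L A] [Algebra L S] (φ : A →ₐ[L] S) {D : Ideal A} (hD : D = RingHom.ker φ) {ι : Type*}
    {y : ι → A} (hy : AlgebraicIndependent L fun j => φ (y j)) :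
    AlgebraicIndependent L fun j => Ideal.Quotient.mk D (y j) :=
  algebraicIndependent_of_ker_le (Ideal.Quotient.mkₐ L D) φ (fun z hz => by
    rw [← RingHom.mem_ker, ← hD]
    exact Ideal.Quotient.eq_zero_iff_mem.1 hz) hy

end Relations

section Orbits

variable {K : Type*} [Field K] {G : Type*} [Group G] [AffineVariety K G]
  {X : Type*} [AffineVariety K X] [MulAction G X] [GVariety K G X]
  {L : Type*} [Field L] [Algebra K L] [Algebra (CoordRing K X) L]
  [IsScalarTower K (CoordRing K X) L] [IsFractionRing (CoordRing K X) L]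

theorem algebraicIndependent_coaction_of_orbitMap (x : X) {r : ℕ} {b : Fin r → CoordRing K X}
    (hb : AlgebraicIndependent K fun j => orbitMap K G x (b j)) :
    AlgebraicIndependent L fun j => inclL K G X L (coaction K G (b j)) := by
  refine algebraicIndependent_of_specialization (IsFractionRing.injective _ L) (evalAt K x) ?_
  simp only [← evalLeft_coaction] at hb
  exact hb

theorem exists_orbitMap_algebraicIndependent [IsAlgClosed K] {r : ℕ} {b : Fin r → CoordRing K X}
    (hb : AlgebraicIndependent L fun j => inclL K G X L (coaction K G (b j))) :
    ∃ x : X, AlgebraicIndependent K fun j => orbitMap K G x (b j) := by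
  obtain ⟨f, hf, hfε⟩ := exists_algebraicIndependent_specialization
    (IsFractionRing.injective (CoordRing K X) L) hb
  obtain ⟨x, hx⟩ : ∃ x, f.1 x ≠ 0 := by
    by_contra! h
    exact hf (Subtype.ext (funext h))
  refine ⟨x, ?_⟩
  simp only [← evalLeft_coaction]
  exact hfε (evalAt K x) hx

/-- The indices of an algebraically independent subfamily can be listed in increasing order. -/
theorem exists_strictMono_algebraicIndependent {L S : Type*} [Field L] [CommRing S]
    [Algebra L S] {n d : ℕ} {g : Fin n → S} {i : Fin d → Fin n} (hi : AlgebraicIndependent L fun j => g (i j)) :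
    ∃ i' : Fin d → Fin n, StrictMono i' ∧ AlgebraicIndependent L fun j => g (i' j) := by
  classical
  have hinj : Function.Injective i := fun j k h => hi.injective (congrArg g h)
  have hcard : (Finset.univ.image i).card = d := by
    rw [Finset.card_image_of_injective _ hinj, Finset.card_fin]
  let e := (Finset.univ.image i).orderEmbOfFin hcard
  have he : ∀ j, ∃ k, i k = e j := fun j => by
    obtain ⟨k, -, hk⟩ := Finset.mem_image.1
      (Finset.orderEmbOfFin_mem (Finset.univ.image i) hcard j)
    exact ⟨k, hk⟩
  choose σ hσ using he
  refine ⟨e, e.strictMono, ?_⟩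
  simp only [← hσ]
  exact hi.comp σ fun j k h => e.injective (by rw [← hσ, ← hσ, h])

end Orbits

/-! ### The ideals of the theorem -/

section Ideals

variable {K : Type*} [Field K] {G : Type*} [Group G] [AffineVariety K G]
  {X : Type*} [AffineVariety K X] [MulAction G X] [GVariety K G X]
  {L : Type*} [Field L] [Algebra K L] [Algebra (CoordRing K X) L]
  [IsScalarTower K (CoordRing K X) L] {n s : ℕ}

/-- The elements `gᵢ` of `L ⊗ K[G]` with `gᵢ(σ) = σ⁻¹ · aᵢ`: the coordinates of the orbit map of the
generic point of `X`. -/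
noncomputable def genericPoint (K : Type*) [Field K] (G : Type*) [Group G] [AffineVariety K G]
    {X : Type*} [AffineVariety K X] [MulAction G X] [GVariety K G X] (L : Type*) [Field L]
    [Algebra K L] [Algebra (CoordRing K X) L] [IsScalarTower K (CoordRing K X) L] {n : ℕ}
    (a : Fin n → CoordRing K X) (k : Fin n) : L ⊗[K] CoordRing K G :=
  inclL K G X L (coaction K G (a k))

theorem DHat_eq_ker (a : Fin n → CoordRing K X) :
    DHat K G L a = RingHom.ker (graphHom (genericPoint K G L a)) :=
  (ker_graphHom (genericPoint K G L a)).symm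

theorem graphHom_polyIncl (a : Fin n → CoordRing K X) (f : MvPolynomial (Fin n) K) :
    graphHom (genericPoint K G L a) (polyIncl K G L f) =
      MvPolynomial.aeval (genericPoint K G L a) f := by
  have h : ((graphHom (genericPoint K G L a)).restrictScalars K).comp (polyIncl K G L) =
      MvPolynomial.aeval (genericPoint K G L a) := by
    ext i
    rw [AlgHom.comp_apply, polyIncl, MvPolynomial.aeval_X, MvPolynomial.aeval_X]
    exact graphHom_X _ i
  exact DFunLike.congr_fun h f

theorem EHat_eq_comap (a : Fin n → CoordRing K X) (f : Fin s → MvPolynomial (Fin n) K) :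
    EHat K G L a f = (Ideal.span (Set.range fun j =>
      MvPolynomial.aeval (genericPoint K G L a) (f j))).comap
        (graphHom (genericPoint K G L a)) := by
  simp only [← graphHom_polyIncl]
  rw [comap_graphHom_span, ← DHat_eq_ker, EHat]

theorem EElim_eq_comap (a : Fin n → CoordRing K X) (f : Fin s → MvPolynomial (Fin n) K) :
    EElim K G L a f = (Ideal.span (Set.range fun j =>
      MvPolynomial.aeval (genericPoint K G L a) (f j))).comap
        (MvPolynomial.aeval (genericPoint K G L a) : _ →ₐ[L] L ⊗[K] CoordRing K G) := by
  rw [EElim, EHat_eq_comap]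
  ext p
  rw [Ideal.mem_comap, Ideal.mem_comap, Ideal.mem_comap, graphHom_includeLeft]

theorem tameCondition_of_ne_top [FaithfulSMul (CoordRing K X) L] (a : Fin n → CoordRing K X)
    (f : Fin s → MvPolynomial (Fin n) K)
    (h : Ideal.span (Set.range fun j => MvPolynomial.aeval (genericPoint K G L a) (f j)) ≠ ⊤) :
    TameCondition K G L a f := by
  intro r hr
  by_cases hr0 : r = 0
  · exact hr0 ▸ IsNilpotent.zero
  refine absurd (Ideal.eq_top_of_isUnit_mem _ hr ?_) h
  have hrL : algebraMap (CoordRing K X) L r ≠ 0 := by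
    rwa [Ne, FaithfulSMul.algebraMap_eq_zero_iff]
  have : inclL K G X L (r ⊗ₜ[K] 1) = algebraMap L (L ⊗[K] CoordRing K G)
      (algebraMap (CoordRing K X) L r) := by
    simp [inclL]
  rw [this]
  exact hrL.isUnit.map (algebraMap L (L ⊗[K] CoordRing K G))

theorem algebraicIndependent_mk_DHat (a : Fin n → CoordRing K X) {i : Fin s → Fin n}
    (hi : AlgebraicIndependent L (fun j => genericPoint K G L a (i j))) :
    AlgebraicIndependent L (fun j : Fin s =>
      Ideal.Quotient.mk (DHat K G L a) (indet K G L (i j))) := by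
  refine algebraicIndependent_mk_of_eq_ker (graphHom (genericPoint K G L a)) (DHat_eq_ker a) ?_
  simp only [indet, graphHom_X]
  exact hi

end Ideals

section Main

variable {K : Type*} [Field K] [IsAlgClosed K] {G : Type*} [Group G] [AffineVariety K G]
  {X : Type*} [AffineVariety K X] [MulAction G X] [GVariety K G X]
  {L : Type*} [Field L] [Algebra K L] [Algebra (CoordRing K X) L]
  [IsScalarTower K (CoordRing K X) L] [IsFractionRing (CoordRing K X) L] {n d : ℕ}

/-- Maximal algebraically independent subfamilies of `g₁, …, gₙ` have as many members as the maximal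
dimension of an orbit. -/
theorem exists_strictMono_maximal_algebraicIndependent (a : Fin n → CoordRing K X)
    (ha : Algebra.adjoin K (Set.range a) = ⊤)
    (hd : IsGreatest (Set.range fun x : X => dimSubset K (MulAction.orbit G x))
      (d : WithBot ℕ∞)) :
    ∃ i : Fin d → Fin n, StrictMono i ∧
      AlgebraicIndependent L (fun j => genericPoint K G L a (i j)) ∧
      ∀ k, ¬ AlgebraicIndependent L (Fin.cons (genericPoint K G L a k)
        fun j => genericPoint K G L a (i j) : Fin (d + 1) → L ⊗[K] CoordRing K G) := by
  obtain ⟨⟨x, hx⟩, hmax⟩ := hd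
  obtain ⟨i₀, hi₀⟩ := exists_algebraicIndependent_of_le_dimSubset_orbit x ha hx.ge
  obtain ⟨i, hi, hig⟩ := exists_strictMono_algebraicIndependent (g := genericPoint K G L a)
    (algebraicIndependent_coaction_of_orbitMap (L := L) x hi₀)
  refine ⟨i, hi, hig, fun k hk => ?_⟩
  have hcons : (Fin.cons (genericPoint K G L a k)
      fun j => genericPoint K G L a (i j) : Fin (d + 1) → L ⊗[K] CoordRing K G) =
        fun j => inclL K G X L (coaction K G (a ((Fin.cons k i : Fin (d + 1) → Fin n) j))) := by
    funext j
    refine Fin.cases ?_ (fun j => ?_) j <;> simp [genericPoint]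
  rw [hcons] at hk
  obtain ⟨y, hy⟩ := exists_orbitMap_algebraicIndependent hk
  have h1 : ((d + 1 : ℕ) : WithBot ℕ∞) ≤ (d : ℕ) :=
    (le_dimSubset_orbit_of_algebraicIndependent y hy).trans (hmax ⟨y, rfl⟩)
  have h2 : d + 1 ≤ d := by exact_mod_cast h1
  omega

end Main

end CrossSection

theorem mainTheorem12 {K : Type*} [Field K] [IsAlgClosed K]
    {G : Type*} [Group G] [CrossSection.AffineVariety K G] [CrossSection.LinearAlgebraicGroup K G]
    {X : Type*} [CrossSection.AffineVariety K X] [MulAction G X] [CrossSection.GVariety K G X]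
    (hX : CrossSection.IsIrreducibleVariety K X)
    (L : Type*) [Field L] [Algebra K L] [Algebra (CrossSection.CoordRing K X) L]
    [IsScalarTower K (CrossSection.CoordRing K X) L]
    [IsFractionRing (CrossSection.CoordRing K X) L]
    {n : ℕ} (a : Fin n → CrossSection.CoordRing K X)
    (ha : Algebra.adjoin K (Set.range a) = ⊤)
    (d : ℕ)
    (hd : IsGreatest (Set.range fun x : X => CrossSection.dimSubset K (MulAction.orbit G x))
      (d : WithBot ℕ∞)) :
    ∃ i : Fin d → Fin n, StrictMono i ∧
      AlgebraicIndependent L (fun j : Fin d =>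
        Ideal.Quotient.mk (CrossSection.DHat K G L a) (CrossSection.indet K G L (i j))) ∧
      ∃ U : Set (Fin d → K),
        @IsOpen _ (CrossSection.zariski K (Fin d → K)) U ∧
        @Dense _ (CrossSection.zariski K (Fin d → K)) U ∧
        ∀ β ∈ U, ∀ f : Fin d → MvPolynomial (Fin n) K,
          (∀ j, f j = MvPolynomial.X (i j) - MvPolynomial.C (β j)) →
          CrossSection.TameCondition K G L a f ∧
          ringKrullDim (CrossSection.BigRing K G L n ⧸ CrossSection.EHat K G L a f)
              + (d : WithBot ℕ∞) = CrossSection.dimVariety K G ∧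
          ringKrullDim (MvPolynomial (Fin n) L ⧸ CrossSection.EElim K G L a f) = 0 := by
  open CrossSection in
  obtain ⟨i, hi, hig, hmax⟩ :=
    exists_strictMono_maximal_algebraicIndependent (L := L) a ha hd
  obtain ⟨h, hh, hdim⟩ := exists_ringKrullDim_fibre_coordRing hig
  choose c hc hcβ using fun k => exists_aeval_mem_span_sub (hmax k)
  obtain ⟨H, hH, hHβ⟩ := exists_ne_zero_of_eval_ne_zero (K := K)
    (mul_ne_zero hh (Finset.prod_ne_zero_iff.2 fun k (_ : k ∈ Finset.univ) => hc k))
  have : Infinite K := IsAlgClosed.instInfinite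
  refine ⟨i, hi, algebraicIndependent_mk_DHat a hig, {β | MvPolynomial.eval β H ≠ 0},
    isOpen_ne_zero H, dense_ne_zero hH, fun β hβ f hf => ?_⟩
  have hβ' := hHβ β hβ
  rw [map_mul, map_prod] at hβ'
  have hspan : (Ideal.span (Set.range fun j => MvPolynomial.aeval (genericPoint K G L a) (f j))) =
      Ideal.span (Set.range fun j => genericPoint K G L a (i j) -
        algebraMap L (L ⊗[K] CoordRing K G) (algebraMap K L (β j))) := by
    congr 2
    funext j
    rw [hf, map_sub, MvPolynomial.aeval_X, MvPolynomial.aeval_C,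
      IsScalarTower.algebraMap_apply K L (L ⊗[K] CoordRing K G)]
  have hdimβ := hdim _ (left_ne_zero_of_mul hβ')
  rw [← hspan] at hdimβ
  have hne : Ideal.span (Set.range fun j =>
      MvPolynomial.aeval (genericPoint K G L a) (f j)) ≠ ⊤ := by
    -- The quotient by the unit ideal has dimension `⊥`, but `dim G` is a natural number.
    intro htop
    obtain ⟨N, -, -, -, hN⟩ := exists_mvPolynomial_isIntegral_coordRing (K := K) (G := G)
    have : Subsingleton ((L ⊗[K] CoordRing K G) ⧸ Ideal.span (Set.range fun j =>
      MvPolynomial.aeval (genericPoint K G L a) (f j))) := Ideal.Quotient.subsingleton_iff.2 htop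
    rw [ringKrullDim_eq_bot_of_subsingleton, WithBot.bot_add, hN] at hdimβ
    exact WithBot.bot_ne_natCast N hdimβ
  have : FaithfulSMul (CoordRing K X) L :=
    (faithfulSMul_iff_algebraMap_injective _ _).2 (IsFractionRing.injective _ _)
  refine ⟨tameCondition_of_ne_top a f hne, ?_, ?_⟩
  · rw [EHat_eq_comap]
    exact (congrArg (· + _) (ringKrullDim_quotient_comap _ (graphHom_surjective _) _)).trans hdimβ
  · rw [EElim_eq_comap]
    refine ringKrullDim_quotient_eq_zero _ hne fun k => ?_
    rw [hspan]
    exact hcβ k _ (Finset.prod_ne_zero_iff.1 (right_ne_zero_of_mul hβ') k (Finset.mem_univ k))
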